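/- Let $[a_{ij}]_{i,j\in I}$ ($I$ finite) be a generalized Cartan matrix symmetrized by positive integers $d_i$ ($d_ia_{ij}=d_ja_{ji}$), let $Q^\vee$ be a free $\mathbb Z$-module, $P=\mathrm{Hom}(Q^\vee,\mathbb Z)$, and let $\alpha_i^\vee\in Q^\vee$, $\alpha_i\in P$ be linearly independent families with $\langle\alpha_i^\vee,\alpha_j\rangle=a_{ij}$, and $\Lambda_j\in P$ with $\langle\alpha_i^\vee,\Lambda_j\rangle=\delta_{ij}$. Put $\rho=\sum_i\Lambda_i$, $P_+=\{\lambda\in P:\langle\alpha_i^\vee,\lambda\rangle\ge 0\ \forall i\}$, let $W=\langle s_i\rangle_{i\in I}$ be the Weyl group, acting on $P$ by $s_i(\lambda)=\lambda-\langle\alpha_i^\vee,\lambda\rangle\alpha_i$, and put $w\circ\lambda=w(\lambda+\rho)-\rho$. Let $\mathfrak g$ be the Kac–Moody algebra over $\mathbb C$ given by generators $e_i,f_i$ and $h\in Q^\vee\otimes\mathbb C$ with the Serre relations, and $U_q(\mathfrak g)$ its quantized enveloping algebra over $\mathbb C(q)$. Let $U_-$ be either $U(\mathfrak n_-)$, where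 $\mathfrak n_-\subset\mathfrak g$ is the Lie subalgebra generated by the $f_i$ (Kac–Moody case), or the subalgebra $U_q(\mathfrak n_-)\subset U_q(\mathfrak g)$ generated by the $f_i$ ($q$-difference case). For $w\in W$ with reduced expression $w=s_{j_m}\cdots s_{j_1}$ and $\lambda\in P_+$ put $$F_{w,\lambda}=f_{j_m}^{\langle\alpha_{j_m}^\vee,\,s_{j_{m-1}}\cdots s_{j_1}\circ\lambda\rangle+1}\cdots f_{j_2}^{\langle\alpha_{j_2}^\vee,\,s_{j_1}\circ\lambda\rangle+1}f_{j_1}^{\langle\alpha_{j_1}^\vee,\lambda\rangle+1}\in U_-,$$ which is independent of the reduced expression. Let $\tilde U_-=U_-[f_i^{-1}\mid i\in I]$, and let $D(\tilde U_-^P)$ be the algebra generated by $\tilde U_-^P=\{(a_\lambda)_{\lambda\in P}\}$ and symbols $\tau^\mu$ ($\mu\in P$), free over $\tilde U_-^P$ on the $\tau^\mu$, with $\tau^\mu\tau^\nu=\tau^{\mu+\nu}$ and $\tau^\mu (a_\lambda)_\lambda=(a_{\lambda+\mu})_\lambda\tau^\mu$. Identify $\beta\in Q^\vee$ with $(\langle\beta,\lambda\rangle)_\lambda$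 in the Kac–Moody case, respectively $q^\beta$ with $(q^{\langle\beta,\lambda\rangle})_\lambda$ in the $q$-difference case, and put $f_i^\beta=(f_i^{\langle\beta,\lambda\rangle})_\lambda$. Let $U_-^{\rm pa}\subset \tilde U_-^P$ be the subalgebra generated by $U_-$ (constant families) and all $\beta$ (respectively $q^\beta$), $\beta\in Q^\vee$. The simple reflection $s_i$ acts on $D(\tilde U_-^P)$ by $x\mapsto f_i^{\alpha_i^\vee}\,\tilde s_i(x)\,f_i^{-\alpha_i^\vee}$, where $\tilde s_i((a_\lambda)_\lambda\tau^\mu)=(a_{s_i(\lambda)})_\lambda\tau^{s_i(\mu)}$. For $\mu\in P_+$ and $w=s_{j_m}\cdots s_{j_1}$ (reduced) the quantum $\tau$-function is $\tau_{(w(\mu))}=w(\tau^\mu)=s_{j_m}(\cdots s_{j_1}(\tau^\mu)\cdots)$. It is called regular if $\tau_{(w(\mu))}=a\,\tau^{w(\mu)}$ with $a\in U_-^{\rm pa}$, namely with $a$ a polynomial in $\{f_i,\alpha_i^\vee\}_{i\in I}$ (respectively in $\{f_i,q^{\pm\alpha_i^\vee}\}_{i\in I}$). **Proposition.** In each of the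 two cases: if $F_{w,\lambda+\mu}\in U_-F_{w,\lambda}$ for all $\lambda,\mu\in P_+$ and all $w\in W$, then all quantum $\tau$-functions $\tau_{(w(\mu))}$ ($w\in W$, $\mu\in P_+$) are regular. -/

import Mathlib

noncomputable section

namespace QuantumTau

/-! ### Symmetrizable generalized Cartan matrices, weights, Weyl group -/

/-- A symmetrizable generalized Cartan matrix `a`, symmetrized by positive integers `d`, realized
in a coroot lattice `Qv` and its dual, the weight lattice `P = Hom(Qv, ℤ)`, with simple coroots,
simple roots and fundamental weights. -/
structure CartanData (I : Type*) [DecidableEq I] (Qv : Type*) [AddCommGroup Qv] where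
  a : Matrix I I ℤ
  d : I → ℕ
  d_pos : ∀ i, 0 < d i
  a_diag : ∀ i, a i i = 2
  a_nonpos : ∀ i j, i ≠ j → a i j ≤ 0
  a_zero_iff : ∀ i j, a i j = 0 ↔ a j i = 0
  a_symm : ∀ i j, (d i : ℤ) * a i j = (d j : ℤ) * a j i
  coroot : I → Qv
  root : I → Module.Dual ℤ Qv
  pairing : ∀ i j, root j (coroot i) = a i j
  coroot_indep : LinearIndependent ℤ coroot
  root_injective : Function.Injective root
  fund : I → Module.Dual ℤ Qv
  fund_coroot : ∀ i j, fund j (coroot i) = if i = j then 1 else 0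

namespace CartanData

variable {I : Type*} [DecidableEq I] {Qv : Type*} [AddCommGroup Qv] (R : CartanData I Qv)

/-- Dominant integral weights: `⟨αᵢ^∨, lam⟩ ≥ 0` for all `i`. -/
def IsDominant (lam : Module.Dual ℤ Qv) : Prop := ∀ i, 0 ≤ lam (R.coroot i)

/-- The Weyl vector `ρ = ∑ Λᵢ`. -/
def rho [Fintype I] : Module.Dual ℤ Qv := ∑ i, R.fund i

/-- The simple reflection `sᵢ` on the weight lattice. -/
def refl (i : I) (lam : Module.Dual ℤ Qv) : Module.Dual ℤ Qv :=
  lam - lam (R.coroot i) • R.root i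

/-- The action on weights of `s_{i₁} s_{i₂} ⋯ s_{iₙ}`, for the word `[i₁, …, iₙ]`. -/
def act (l : List I) (lam : Module.Dual ℤ Qv) : Module.Dual ℤ Qv :=
  l.foldr R.refl lam

/-- The shifted action `w ∘ lam = w (lam + ρ) - ρ`. -/
def dotAct [Fintype I] (l : List I) (lam : Module.Dual ℤ Qv) : Module.Dual ℤ Qv :=
  R.act l (lam + R.rho) - R.rho

/-- The order of `sᵢ sⱼ` (`i ≠ j`) as a function of `aᵢⱼ aⱼᵢ`; the value `0` means that there is
no relation. -/
def coxeterOrder (n : ℤ) : ℕ :=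
  if n = 0 then 2 else if n = 1 then 3 else if n = 2 then 4 else if n = 3 then 6 else 0

/-- The Coxeter matrix of the generalized Cartan matrix. -/
def coxeterMatrix : CoxeterMatrix I where
  M := Matrix.of fun i j => if i = j then 1 else coxeterOrder (R.a i j * R.a j i)
  isSymm := by
    ext i j
    simp only [Matrix.transpose_apply, Matrix.of_apply]
    by_cases h : i = j
    · simp [h]
    · simp [h, Ne.symm h, mul_comm]
  diagonal := by simp
  off_diagonal := by
    intro i j h
    simp only [Matrix.of_apply, h, if_false, coxeterOrder]
    split_ifs <;> simp

/-- The Weyl group. -/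
abbrev Weyl : Type _ := R.coxeterMatrix.Group

/-- The word `l = [i₁, …, iₙ]` is a reduced expression `s_{i₁} ⋯ s_{iₙ}` of `w`. -/
def IsReducedExpr (w : R.Weyl) (l : List I) : Prop :=
  R.coxeterMatrix.toCoxeterSystem.wordProd l = w ∧ R.coxeterMatrix.toCoxeterSystem.IsReduced l

end CartanData

/-! ### The Kac-Moody algebra and `U(𝔫₋)` -/

/-- Generators `eᵢ`, `fᵢ` (`i ∈ I`) and a family indexed by `H`. -/
inductive Gen (I H : Type*)
  | e : I → Gen I H
  | f : I → Gen I H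
  | h : H → Gen I H

section KacMoody

open scoped TensorProduct

variable {I : Type*} [DecidableEq I] {Qv : Type*} [AddCommGroup Qv] (R : CartanData I Qv)

/-- The pairing of `β ∈ Qv ⊗ ℂ` with a weight. -/
def complexPairing (lam : Module.Dual ℤ Qv) : ℂ ⊗[ℤ] Qv →ₗ[ℂ] ℂ :=
  LinearMap.liftBaseChange ℂ ((Algebra.linearMap ℤ ℂ).comp lam)

/-- The free Lie algebra on `eᵢ`, `fᵢ` and `h_β`, `β ∈ Qv ⊗ ℂ`. -/
abbrev KMFree (I Qv : Type*) [AddCommGroup Qv] : Type _ :=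
  FreeLieAlgebra ℂ (Gen I (ℂ ⊗[ℤ] Qv))

/-- The generator `eᵢ`. -/
abbrev kmE (Qv : Type*) [AddCommGroup Qv] {I : Type*} (i : I) : KMFree I Qv :=
  FreeLieAlgebra.of ℂ (Gen.e i)

/-- The generator `fᵢ`. -/
abbrev kmF (Qv : Type*) [AddCommGroup Qv] {I : Type*} (i : I) : KMFree I Qv :=
  FreeLieAlgebra.of ℂ (Gen.f i)

/-- The generator `h_β`. -/
abbrev kmH (I : Type*) {Qv : Type*} [AddCommGroup Qv] (b : ℂ ⊗[ℤ] Qv) : KMFree I Qv :=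
  FreeLieAlgebra.of ℂ (Gen.h b)

/-- The defining relations of the Kac-Moody algebra. -/
inductive KMRel : KMFree I Qv → KMFree I Qv → Prop
  | h_add (b c : ℂ ⊗[ℤ] Qv) : KMRel (kmH I b + kmH I c) (kmH I (b + c))
  | h_smul (z : ℂ) (b : ℂ ⊗[ℤ] Qv) : KMRel (z • kmH I b) (kmH I (z • b))
  | h_h (b c : ℂ ⊗[ℤ] Qv) : KMRel ⁅kmH I b, kmH I c⁆ 0
  | h_e (b : ℂ ⊗[ℤ] Qv) (j : I) :
      KMRel ⁅kmH I b, kmE Qv j⁆ (complexPairing (R.root j) b • kmE Qv j)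
  | h_f (b : ℂ ⊗[ℤ] Qv) (j : I) :
      KMRel ⁅kmH I b, kmF Qv j⁆ (-(complexPairing (R.root j) b) • kmF Qv j)
  | e_f (i j : I) :
      KMRel ⁅kmE Qv i, kmF Qv j⁆ (if i = j then kmH I (1 ⊗ₜ[ℤ] R.coroot i) else 0)
  | serre_e (i j : I) : i ≠ j →
      KMRel ((LieAlgebra.ad ℂ (KMFree I Qv) (kmE Qv i) ^ (1 - R.a i j).toNat) (kmE Qv j)) 0
  | serre_f (i j : I) : i ≠ j →
      KMRel ((LieAlgebra.ad ℂ (KMFree I Qv) (kmF Qv i) ^ (1 - R.a i j).toNat) (kmF Qv j)) 0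

/-- The ideal generated by the defining relations. -/
def kmIdeal : LieIdeal ℂ (KMFree I Qv) :=
  LieSubmodule.lieSpan ℂ (KMFree I Qv) {z | ∃ x y, KMRel R x y ∧ z = x - y}

/-- The Kac-Moody Lie algebra `𝔤`. -/
abbrev KacMoody : Type _ := KMFree I Qv ⧸ kmIdeal R

/-- The element `fᵢ` of `𝔤`. -/
def kmf (i : I) : KacMoody R := LieSubmodule.Quotient.mk' (kmIdeal R) (kmF Qv i)

/-- The Lie subalgebra `𝔫₋` of `𝔤` generated by the `fᵢ`. -/
def nMinus : LieSubalgebra ℂ (KacMoody R) :=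
  LieSubalgebra.lieSpan ℂ (KacMoody R) (Set.range (kmf R))

/-- `U₋ = U(𝔫₋)`, the universal enveloping algebra. -/
abbrev UMinus : Type _ := UniversalEnvelopingAlgebra ℂ (nMinus R)

/-- The dependent variable `fᵢ ∈ U(𝔫₋)`. -/
def uf (i : I) : UMinus R :=
  UniversalEnvelopingAlgebra.ι ℂ
    (⟨kmf R i, LieSubalgebra.subset_lieSpan (Set.mem_range_self i)⟩ : nMinus R)

end KacMoody

/-! ### The quantized enveloping algebra and `U_q(𝔫₋)` -/

section QDifference

/-- The field `ℂ(q)`. -/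
abbrev Cq : Type := RatFunc ℂ

/-- The indeterminate `q`. -/
abbrev qq : Cq := RatFunc.X

/-- The `q`-number `[n]_p = (pⁿ - p⁻ⁿ) / (p - p⁻¹)`. -/
def qNum (p : Cq) (n : ℕ) : Cq := (p ^ (n : ℤ) - p ^ (-(n : ℤ))) / (p - p⁻¹)

/-- The `q`-factorial `[n]_p!`. -/
def qFact (p : Cq) (n : ℕ) : Cq := ∏ m ∈ Finset.range n, qNum p (m + 1)

variable {I : Type*} [DecidableEq I] {Qv : Type*} [AddCommGroup Qv] (R : CartanData I Qv)

/-- `qᵢ = q ^ dᵢ`. -/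
def qi (i : I) : Cq := qq ^ R.d i

/-- The free associative algebra on `eᵢ`, `fᵢ` and `q^β`, `β ∈ Qv`. -/
abbrev UqFree (I Qv : Type*) : Type _ := FreeAlgebra Cq (Gen I Qv)

/-- The generator `eᵢ`. -/
abbrev uqE (Qv : Type*) {I : Type*} (i : I) : UqFree I Qv := FreeAlgebra.ι Cq (Gen.e i)

/-- The generator `fᵢ`. -/
abbrev uqF (Qv : Type*) {I : Type*} (i : I) : UqFree I Qv := FreeAlgebra.ι Cq (Gen.f i)

/-- The generator `q^β`. -/
abbrev uqK (I : Type*) {Qv : Type*} (b : Qv) : UqFree I Qv := FreeAlgebra.ι Cq (Gen.h b)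

/-- The divided power `x^{(n)} = xⁿ / [n]_p!`. -/
def divPow {B : Type*} [Ring B] [Algebra Cq B] (p : Cq) (x : B) (n : ℕ) : B :=
  (qFact p n)⁻¹ • x ^ n

/-- The left-hand side `∑ₖ (-1)ᵏ x^{(N-k)} y x^{(k)}` of the `q`-Serre relation. -/
def qSerre {B : Type*} [Ring B] [Algebra Cq B] (p : Cq) (N : ℕ) (x y : B) : B :=
  ∑ k ∈ Finset.range (N + 1), (-1) ^ k * (divPow p x (N - k) * y * divPow p x k)

/-- The defining relations of `U_q(𝔤)`. -/
inductive UqRel : UqFree I Qv → UqFree I Qv → Prop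
  | k_mul (b c : Qv) : UqRel (uqK I b * uqK I c) (uqK I (b + c))
  | k_zero : UqRel (uqK I 0) 1
  | k_e (b : Qv) (j : I) :
      UqRel (uqK I b * uqE Qv j * uqK I (-b)) (qq ^ (R.root j b) • uqE Qv j)
  | k_f (b : Qv) (j : I) :
      UqRel (uqK I b * uqF Qv j * uqK I (-b)) (qq ^ (-(R.root j b)) • uqF Qv j)
  | e_f (i j : I) :
      UqRel (uqE Qv i * uqF Qv j - uqF Qv j * uqE Qv i)
        (if i = j then
          (qi R i - (qi R i)⁻¹)⁻¹ •
            (uqK I (R.d i • R.coroot i) - uqK I (-(R.d i • R.coroot i)))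
        else 0)
  | serre_e (i j : I) : i ≠ j →
      UqRel (qSerre (qi R i) (1 - R.a i j).toNat (uqE Qv i) (uqE Qv j)) 0
  | serre_f (i j : I) : i ≠ j →
      UqRel (qSerre (qi R i) (1 - R.a i j).toNat (uqF Qv i) (uqF Qv j)) 0

/-- The algebra `U_q(𝔤)` over `ℂ(q)`. -/
abbrev Uq : Type _ := RingQuot (UqRel R)

/-- The element `fᵢ` of `U_q(𝔤)`. -/
def uqf (i : I) : Uq R := RingQuot.mkAlgHom Cq (UqRel R) (uqF Qv i)

/-- `U₋ = U_q(𝔫₋)`, the subalgebra of `U_q(𝔤)` generated by the `fᵢ`. -/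
abbrev UqMinus : Subalgebra Cq (Uq R) := Algebra.adjoin Cq (Set.range (uqf R))

/-- The dependent variable `fᵢ ∈ U_q(𝔫₋)`. -/
def uqMinusF (i : I) : UqMinus R :=
  ⟨uqf R i, Algebra.subset_adjoin (Set.mem_range_self i)⟩

end QDifference

/-! ### Localization at the dependent variables -/

section Localization

variable (k : Type*) [Field k] {I : Type*} {A : Type*} [Ring A] [Algebra k A] (f : I → A)

/-- Relations presenting `A[fᵢ⁻¹ | i ∈ I]`: the generators `inl a` form a copy of `A`, and `inr i`
is a two-sided inverse of `fᵢ`. -/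
inductive LocRel : FreeAlgebra k (A ⊕ I) → FreeAlgebra k (A ⊕ I) → Prop
  | add (x y : A) : LocRel (FreeAlgebra.ι k (Sum.inl (x + y)))
      (FreeAlgebra.ι k (Sum.inl x) + FreeAlgebra.ι k (Sum.inl y))
  | mul (x y : A) : LocRel (FreeAlgebra.ι k (Sum.inl (x * y)))
      (FreeAlgebra.ι k (Sum.inl x) * FreeAlgebra.ι k (Sum.inl y))
  | scalar (c : k) : LocRel (FreeAlgebra.ι k (Sum.inl (algebraMap k A c)))
      (algebraMap k (FreeAlgebra k (A ⊕ I)) c)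
  | mul_inv (i : I) :
      LocRel (FreeAlgebra.ι k (Sum.inl (f i)) * FreeAlgebra.ι k (Sum.inr i)) 1
  | inv_mul (i : I) :
      LocRel (FreeAlgebra.ι k (Sum.inr i) * FreeAlgebra.ι k (Sum.inl (f i))) 1

/-- The localization `Ã = A[fᵢ⁻¹ | i ∈ I]`, i.e. the universal `k`-algebra under `A` in which every
`fᵢ` is invertible. By uniqueness of universal objects it is the Ore localization of `A` at the
multiplicative set generated by the `fᵢ` whenever that set is an Ore set. -/
def Loc : Type _ := RingQuot (LocRel k f)

instance : Ring (Loc k f) := inferInstanceAs (Ring (RingQuot (LocRel k f)))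

instance : Algebra k (Loc k f) := inferInstanceAs (Algebra k (RingQuot (LocRel k f)))

/-- The quotient map onto `Ã` from the free algebra. -/
def locMk : FreeAlgebra k (A ⊕ I) →ₐ[k] Loc k f := RingQuot.mkAlgHom k (LocRel k f)

/-- The canonical map `A → Ã`. -/
def toLoc (x : A) : Loc k f := locMk k f (FreeAlgebra.ι k (Sum.inl x))

/-- `fᵢ` as a unit of `Ã`. -/
def fUnit (i : I) : (Loc k f)ˣ where
  val := toLoc k f (f i)
  inv := locMk k f (FreeAlgebra.ι k (Sum.inr i))
  val_inv := by
    have h := RingQuot.mkAlgHom_rel k (LocRel.mul_inv (k := k) (f := f) i)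
    rw [map_mul, map_one] at h
    exact h
  inv_val := by
    have h := RingQuot.mkAlgHom_rel k (LocRel.inv_mul (k := k) (f := f) i)
    rw [map_mul, map_one] at h
    exact h

end Localization

/-! ### Functions on the weight lattice and difference operators -/

section Difference

variable (Qv : Type*) [AddCommGroup Qv] (S : Type*)

/-- The algebra `S^P` of all families `(a_lam)` of elements of `S` indexed by weights. -/
def WeightFun : Type _ := Module.Dual ℤ Qv → S

instance [Ring S] : Ring (WeightFun Qv S) := inferInstanceAs (Ring (Module.Dual ℤ Qv → S))

instance (k : Type*) [CommSemiring k] [Ring S] [Algebra k S] : Algebra k (WeightFun Qv S) :=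
  inferInstanceAs (Algebra k (Module.Dual ℤ Qv → S))

/-- The translation automorphisms `τ^μ ((a_lam)) = (a_{lam + μ})` of `S^P`. -/
instance [Ring S] : MulSemiringAction (Multiplicative (Module.Dual ℤ Qv)) (WeightFun Qv S) where
  smul mu a := fun lam => a (lam + mu.toAdd)
  one_smul a := funext fun lam => congrArg a (add_zero lam)
  mul_smul mu nu a := funext fun lam =>
    congrArg a (show lam + (mu.toAdd + nu.toAdd) = lam + mu.toAdd + nu.toAdd by abel)
  smul_zero _ := rfl
  smul_add _ _ _ := rfl
  smul_one _ := rfl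
  smul_mul _ _ _ := rfl

/-- The algebra `D(S^P) = S^P[τ^μ | μ ∈ P]` of difference operators: the free left `S^P`-module on
the symbols `τ^μ`, with `(a τ^μ) (b τ^ν) = a τ^μ(b) τ^{μ+ν}`. -/
abbrev DiffOp [Ring S] : Type _ :=
  SkewMonoidAlgebra (WeightFun Qv S) (Multiplicative (Module.Dual ℤ Qv))

variable {Qv S}

/-- The constant family with value `x`. -/
def constFun (x : S) : WeightFun Qv S := fun _ => x

/-- A family `a ∈ S^P` as an element of `D(S^P)`. -/
def ofFun [Ring S] (a : WeightFun Qv S) : DiffOp Qv S := SkewMonoidAlgebra.single 1 a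

/-- The quantum Laurent `τ`-monomial `τ^μ`. -/
def tauMon [Ring S] (mu : Module.Dual ℤ Qv) : DiffOp Qv S :=
  SkewMonoidAlgebra.single (Multiplicative.ofAdd mu) 1

/-- The tilde action of the simple reflection `sᵢ` on `D(S^P)`:
`(a_lam) τ^μ ↦ (a_{sᵢ lam}) τ^{sᵢ μ}`. -/
def tildeRefl {I : Type*} [DecidableEq I] (R : CartanData I Qv) [Ring S] (i : I)
    (x : DiffOp Qv S) : DiffOp Qv S :=
  x.sum fun mu a =>
    SkewMonoidAlgebra.single (Multiplicative.ofAdd (R.refl i mu.toAdd))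
      ((fun lam => a (R.refl i lam) : WeightFun Qv S))

end Difference

/-! ### Quantum birational action, quantum `τ`-functions, regularity -/

section Tau

variable {I : Type*} [DecidableEq I] {Qv : Type*} [AddCommGroup Qv] (R : CartanData I Qv)
variable (k : Type*) [Field k] {A : Type*} [Ring A] [Algebra k A] (f : I → A)

/-- The fractional power `fᵢ^β = (fᵢ^{⟨β, lam⟩})_lam`. -/
def fracPow (i : I) (b : Qv) : WeightFun Qv (Loc k f) :=
  fun lam => ((fUnit k f i ^ (lam b) : (Loc k f)ˣ) : Loc k f)

/-- The quantum birational action of the simple reflection `sᵢ`: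
`x ↦ fᵢ^{αᵢ^∨} · s̃ᵢ(x) · fᵢ^{-αᵢ^∨}`. -/
def birRefl (i : I) (x : DiffOp Qv (Loc k f)) : DiffOp Qv (Loc k f) :=
  ofFun (fracPow k f i (R.coroot i)) * tildeRefl R i x * ofFun (fracPow k f i (-R.coroot i))

/-- The quantum birational action of `s_{i₁} ⋯ s_{iₙ}`, for the word `[i₁, …, iₙ]`. -/
def birAct (l : List I) (x : DiffOp Qv (Loc k f)) : DiffOp Qv (Loc k f) :=
  l.foldr (birRefl R k f) x

/-- The quantum `τ`-function `τ_{(w(μ))} = w(τ^μ)`, for `w` given by the word `l`. -/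
def tauFun (l : List I) (mu : Module.Dual ℤ Qv) : DiffOp Qv (Loc k f) :=
  birAct R k f l (tauMon mu)

/-- Given the embedding `prm` of the parameter variables into `Ã^P` (`β` or `q^β`, for `β ∈ Qv`),
the algebra `A^pa` of polynomials in all parameter variables over `A`, as a subalgebra of `Ã^P`. -/
def paramAlg (prm : Qv → WeightFun Qv (Loc k f)) : Subalgebra k (WeightFun Qv (Loc k f)) :=
  Algebra.adjoin k (Set.range (fun x : A => (constFun (toLoc k f x) : WeightFun Qv (Loc k f))) ∪
    Set.range prm)

/-- The subalgebra of `Ã^P` generated by the `fᵢ` and by the parameter variables of `± αᵢ^∨`. -/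
def polyAlg (prm : Qv → WeightFun Qv (Loc k f)) : Subalgebra k (WeightFun Qv (Loc k f)) :=
  Algebra.adjoin k
    (Set.range (fun i : I => (constFun (toLoc k f (f i)) : WeightFun Qv (Loc k f))) ∪
      (Set.range (fun i => prm (R.coroot i)) ∪ Set.range (fun i => prm (-R.coroot i))))

/-- Regularity of a quantum `τ`-function with index `nu`: it is `a τ^nu` with `a ∈ A^pa`, and `a` is
a polynomial in the `fᵢ` and the parameter variables attached to the simple coroots. -/
def IsRegular (prm : Qv → WeightFun Qv (Loc k f)) (nu : Module.Dual ℤ Qv)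
    (x : DiffOp Qv (Loc k f)) : Prop :=
  ∃ a : WeightFun Qv (Loc k f),
    a ∈ paramAlg k f prm ∧ a ∈ polyAlg R k f prm ∧ x = ofFun a * tauMon nu

/-- In the Kac-Moody case: the parameter variable `β`, i.e. the family `(⟨β, lam⟩)_lam`. -/
def kmParam (b : Qv) : WeightFun Qv (Loc k f) := fun lam => ((lam b : ℤ) : Loc k f)

/-- In the `q`-difference case: the parameter variable `q^β`, i.e. the family
`(q^{⟨β, lam⟩})_lam`. -/
def qParam {A : Type*} [Ring A] [Algebra Cq A] (f : I → A) (b : Qv) : WeightFun Qv (Loc Cq f) :=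
  fun lam => algebraMap Cq (Loc Cq f) (qq ^ (lam b))

variable {k}

/-- The element `F_{w,lam}` of `U₋`, for the expression `w = s_{iₙ} ⋯ s_{i₁}` given by the word
`[iₙ, …, i₁]`: the product of the `f_{iₘ}^{⟨α_{iₘ}^∨, s_{iₘ₋₁} ⋯ s_{i₁} ∘ lam⟩ + 1}`. -/
def singF [Fintype I] : List I → Module.Dual ℤ Qv → A
  | [], _ => 1
  | i :: l, lam => f i ^ (R.dotAct l lam (R.coroot i) + 1).toNat * singF l lam

end Tau

end QuantumTau

end

/-! Write `w(τ^μ) = a_w τ^{w(μ)}`. At the weight `-w(λ + ρ + μ)`, with `λ` dominant, the family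
`a_w` takes the value `F_{w,λ+μ} F_{w,λ}⁻¹` (`tauCoeff_act`, `toLoc_singF`), which the divisibility
hypothesis places in the image of `U₋`. Here the exponents in `F_{w,λ}` must be nonnegative, which
is the positivity statement `act_coroot_nonneg` on reduced words.

It remains to pass from these special weights to all of them. Let `B` be the algebra of scalar
functions on weights generated by the parameters of the coroot lattice. If `a_w` is a finite sum `∑
bₘ xₘ` with `bₘ ∈ B` and `xₘ` in the localization, and if the special weights form a set of
uniqueness for `B`, then a linear projection onto the image of `U₋` fixes `a_w`. Hence the `xₘ` can
be taken in `U₋` (`mem_of_mixed`), and `a_w` is a polynomial in the `fᵢ` and the parameters.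

That `a_w` is such a sum follows by induction on the length (`tauCoeff_mem`). Passing from `w` to
`sᵢ w` conjugates by `fᵢ^{αᵢ^∨}` and multiplies by a constant power of `fᵢ`, so it suffices that
`fᵢⁿ fⱼ fᵢ⁻ⁿ` depends on `n` through `B`. The Serre relations give this. In the Kac-Moody case
conjugation minus the identity is nilpotent at `fⱼ`, and the dependence is polynomial in `n`. In the
`q`-case the Serre relation factors by the `q`-binomial theorem with distinct roots, and the
dependence is a sum of exponentials. Uniqueness on dominant weights is the vanishing of a polynomial
that is zero on `ℕ^I`, respectively the independence of characters. -/

noncomputable section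

namespace QuantumTau

namespace CartanData

/-! ### Alternating words in two letters. -/

section AltList

variable {I : Type*}

/-- The alternating word `[i, j, i, …]` of length `n`. -/
def altList (i j : I) : ℕ → List I
  | 0 => []
  | n + 1 => i :: altList j i n

theorem length_altList (i j : I) (n : ℕ) : (altList i j n).length = n := by
  induction n generalizing i j with
  | zero => rfl
  | succ n ih => simp [altList, ih]

theorem altList_add_two (i j : I) (n : ℕ) : altList i j (n + 2) = i :: j :: altList i j n := rfl

theorem altList_add (i j : I) (m n : ℕ) :
    ∃ i' j', altList i j (m + n) = altList i j m ++ altList i' j' n := by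
  induction m generalizing i j with
  | zero => exact ⟨i, j, by simp [altList]⟩
  | succ m ih =>
    obtain ⟨i', j', h⟩ := ih j i
    exact ⟨i', j', by rw [Nat.succ_add, altList, h]; rfl⟩

end AltList

/-! ### The Weyl group action and positivity on dominant weights. -/

section Weyl

variable {I : Type*} [DecidableEq I] {Qv : Type*} [AddCommGroup Qv] (R : CartanData I Qv)

/-- The simple reflection as an endomorphism of the weight lattice. -/
def reflEnd (i : I) : Module.End ℤ (Module.Dual ℤ Qv) where
  toFun := R.refl i
  map_add' x y := by
    simp only [refl, LinearMap.add_apply, add_smul]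
    abel
  map_smul' z x := by
    simp only [refl, LinearMap.smul_apply, smul_assoc, smul_sub, RingHom.id_apply]

theorem reflEnd_apply (i : I) (x : Module.Dual ℤ Qv) : R.reflEnd i x = R.refl i x := rfl

theorem refl_apply (i : I) (x : Module.Dual ℤ Qv) (b : Qv) :
    R.refl i x b = x b - x (R.coroot i) * R.root i b := by
  simp [refl]

theorem refl_apply_coroot (i j : I) (x : Module.Dual ℤ Qv) :
    R.refl i x (R.coroot j) = x (R.coroot j) - x (R.coroot i) * R.a j i := by
  rw [refl_apply, pairing]

theorem refl_apply_coroot_self (i : I) (x : Module.Dual ℤ Qv) :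
    R.refl i x (R.coroot i) = -x (R.coroot i) := by
  rw [refl_apply_coroot, a_diag]; ring

theorem refl_refl (i : I) (x : Module.Dual ℤ Qv) : R.refl i (R.refl i x) = x := by
  ext b
  rw [refl_apply, refl_apply_coroot_self, refl_apply]; ring

theorem reflEnd_mul_self (i : I) : R.reflEnd i * R.reflEnd i = 1 := by
  refine LinearMap.ext fun x => ?_
  exact R.refl_refl i x

/-- Modulo `x`, the product of two reflections is an affine map on the two root coefficients, so a
braid relation becomes an iteration of integer pairs. -/
theorem reflEnd_mul_apply (i j : I) (x : Module.Dual ℤ Qv) (A B : ℤ) :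
    (R.reflEnd i * R.reflEnd j) (x + A • R.root i + B • R.root j) =
      x + (-A - x (R.coroot i) - R.a i j * (-B - x (R.coroot j) - R.a j i * A)) • R.root i +
        (-B - x (R.coroot j) - R.a j i * A) • R.root j := by
  ext b
  simp only [Module.End.mul_apply, reflEnd_apply, refl_apply, LinearMap.add_apply,
    LinearMap.smul_apply, smul_eq_mul, pairing, a_diag]
  ring

theorem coxeterMatrix_apply {i j : I} (h : i ≠ j) :
    R.coxeterMatrix i j = coxeterOrder (R.a i j * R.a j i) := by
  change (if i = j then 1 else coxeterOrder (R.a i j * R.a j i)) = _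
  rw [if_neg h]

/-- The possible entries of a generalized Cartan matrix of rank two, by order of `sᵢ sⱼ`. -/
theorem coxeter_cases {i j : I} (h : i ≠ j) :
    (R.coxeterMatrix i j = 2 ∧ R.a i j = 0 ∧ R.a j i = 0) ∨
    (R.coxeterMatrix i j = 3 ∧ R.a i j = -1 ∧ R.a j i = -1) ∨
    (R.coxeterMatrix i j = 4 ∧ R.a i j = -1 ∧ R.a j i = -2) ∨
    (R.coxeterMatrix i j = 4 ∧ R.a i j = -2 ∧ R.a j i = -1) ∨
    (R.coxeterMatrix i j = 6 ∧ R.a i j = -1 ∧ R.a j i = -3) ∨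
    (R.coxeterMatrix i j = 6 ∧ R.a i j = -3 ∧ R.a j i = -1) ∨
    (R.coxeterMatrix i j = 0 ∧ 4 ≤ R.a i j * R.a j i) := by
  rw [R.coxeterMatrix_apply h]
  have h1 := R.a_nonpos i j h
  have h2 := R.a_nonpos j i h.symm
  have h3 := R.a_zero_iff i j
  generalize R.a i j = x at *
  generalize R.a j i = y at *
  by_cases hx : x = 0
  · have hy := h3.1 hx
    subst hx hy
    simp [coxeterOrder]
  have hy : y ≠ 0 := fun e => hx (h3.2 e)
  have hx' : x ≤ -1 := by omega
  have hy' : y ≤ -1 := by omega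
  by_cases hn : 4 ≤ x * y
  · refine .inr <| .inr <| .inr <| .inr <| .inr <| .inr ⟨?_, hn⟩
    unfold coxeterOrder
    rw [if_neg (by omega), if_neg (by omega), if_neg (by omega), if_neg (by omega)]
  have hxl : -3 ≤ x := by nlinarith
  have hyl : -3 ≤ y := by nlinarith
  interval_cases x <;> interval_cases y <;> simp_all [coxeterOrder]

theorem isLiftable_reflEnd : R.coxeterMatrix.IsLiftable R.reflEnd := by
  intro i j
  by_cases h : i = j
  · subst h
    rw [R.coxeterMatrix.diagonal, pow_one, reflEnd_mul_self]
  refine LinearMap.ext fun x => ?_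
  -- Zero coefficients start the affine iteration; after `m` rounds they must return to zero.
  have hx : x = x + (0 : ℤ) • R.root i + (0 : ℤ) • R.root j := by simp
  rw [Module.End.one_apply]
  rcases R.coxeter_cases h with h | h | h | h | h | h | ⟨h, -⟩
  iterate 6
    obtain ⟨hm, hij, hji⟩ := h
    rw [hm]
    conv_lhs => rw [hx]
    conv_rhs => rw [hx]
    simp only [pow_succ', pow_zero, mul_one, Module.End.mul_apply (_ * _) _,
      reflEnd_mul_apply, hij, hji]
    congr 2
    · congr 1; omega
    · omega
  rw [h, pow_zero, Module.End.one_apply]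

/-- The action of the Weyl group on the weight lattice. -/
def weylRep : R.Weyl →* Module.End ℤ (Module.Dual ℤ Qv) :=
  R.coxeterMatrix.toCoxeterSystem.lift ⟨R.reflEnd, R.isLiftable_reflEnd⟩

local notation "cs" => CoxeterMatrix.toCoxeterSystem (CartanData.coxeterMatrix R)

theorem weylRep_simple (i : I) : R.weylRep ((cs).simple i) = R.reflEnd i :=
  (cs).lift_apply_simple R.isLiftable_reflEnd i

theorem act_cons (i : I) (l : List I) (x : Module.Dual ℤ Qv) :
    R.act (i :: l) x = R.refl i (R.act l x) := rfl

theorem act_eq_weylRep (l : List I) (x : Module.Dual ℤ Qv) :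
    R.act l x = R.weylRep ((cs).wordProd l) x := by
  induction l with
  | nil => simp [act]
  | cons i l ih =>
    rw [act_cons, ih, (cs).wordProd_cons, map_mul, weylRep_simple, Module.End.mul_apply,
      reflEnd_apply]

theorem wordProd_altList_two_mul (i j : I) (n : ℕ) :
    (cs).wordProd (altList i j (2 * n)) = ((cs).simple i * (cs).simple j) ^ n := by
  induction n with
  | zero => simp [altList]
  | succ n ih =>
    rw [show 2 * (n + 1) = 2 * n + 2 by ring, altList_add_two, (cs).wordProd_cons,
      (cs).wordProd_cons, ih, pow_succ', mul_assoc]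

/-- The braid relation, for the orders that occur in a Weyl group. -/
theorem wordProd_altList_comm {i j : I} (h : i ≠ j) :
    (cs).wordProd (altList i j (R.coxeterMatrix i j)) =
      (cs).wordProd (altList j i (R.coxeterMatrix i j)) := by
  have key := (cs).simple_mul_simple_pow i j
  have hinv : ∀ n : ℕ, ((cs).simple j * (cs).simple i) ^ n =
      (((cs).simple i * (cs).simple j) ^ n)⁻¹ := fun n => by
    rw [← inv_pow, mul_inv_rev, (cs).inv_simple, (cs).inv_simple]
  rcases R.coxeter_cases h with h | h | h | h | h | h | h
  · rw [h.1] at key ⊢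
    rw [show (2 : ℕ) = 2 * 1 from rfl, wordProd_altList_two_mul, wordProd_altList_two_mul, hinv,
      eq_inv_iff_mul_eq_one, ← pow_add]
    exact key
  · rw [h.1] at key ⊢
    rw [show (3 : ℕ) = 2 * 1 + 1 from rfl]
    simp only [altList, (cs).wordProd_cons, (cs).wordProd_nil, mul_one]
    rw [← mul_inv_eq_one]
    simp only [mul_inv_rev, (cs).inv_simple]
    rw [← key]
    simp only [pow_succ, pow_zero, one_mul, mul_assoc]
  · rw [h.1] at key ⊢
    rw [show (4 : ℕ) = 2 * 2 from rfl, wordProd_altList_two_mul, wordProd_altList_two_mul, hinv,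
      eq_inv_iff_mul_eq_one, ← pow_add]
    exact key
  · rw [h.1] at key ⊢
    rw [show (4 : ℕ) = 2 * 2 from rfl, wordProd_altList_two_mul, wordProd_altList_two_mul, hinv,
      eq_inv_iff_mul_eq_one, ← pow_add]
    exact key
  · rw [h.1] at key ⊢
    rw [show (6 : ℕ) = 2 * 3 from rfl, wordProd_altList_two_mul, wordProd_altList_two_mul, hinv,
      eq_inv_iff_mul_eq_one, ← pow_add]
    exact key
  · rw [h.1] at key ⊢
    rw [show (6 : ℕ) = 2 * 3 from rfl, wordProd_altList_two_mul, wordProd_altList_two_mul, hinv,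
      eq_inv_iff_mul_eq_one, ← pow_add]
    exact key
  · rw [h.1]; rfl

/-- An element is an alternating product followed by an element without the two descents. -/
theorem exists_altList_mul (n : ℕ) : ∀ (i j : I) (w : R.Weyl), (cs).length w = n →
    ¬ (cs).IsLeftDescent w i → ∃ (p : ℕ) (v : R.Weyl), w = (cs).wordProd (altList j i p) * v ∧
      (cs).length w = p + (cs).length v ∧ ¬ (cs).IsLeftDescent v i ∧ ¬ (cs).IsLeftDescent v j := by
  induction n with
  | zero =>
    intro i j w hw hi
    refine ⟨0, w, by simp [altList], by simp, hi, ?_⟩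
    rw [(cs).length_eq_zero_iff.1 hw]
    exact (cs).not_isLeftDescent_one j
  | succ n ih =>
    intro i j w hw hi
    by_cases hj : (cs).IsLeftDescent w j
    · have hlen := (cs).isLeftDescent_iff.1 hj
      -- Once `sⱼ` is stripped, `j` is no longer a descent, so the two letters exchange roles.
      obtain ⟨p, v, h1, h2, h3, h4⟩ := ih j i ((cs).simple j * w) (by omega)
        ((cs).isLeftDescent_iff_not_isLeftDescent_mul.1 hj)
      refine ⟨p + 1, v, ?_, by omega, h4, h3⟩
      rw [altList, (cs).wordProd_cons, mul_assoc, ← h1, ← mul_assoc, (cs).simple_mul_simple_self,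
        one_mul]
    · exact ⟨0, w, by simp [altList], by simp, hi, hj⟩

/-- A prefix of full braid length could be rewritten to begin with `i`, which would make `i` a left
descent of `w`. -/
theorem altList_length_lt {i j : I} (h : i ≠ j) {p : ℕ} {w v : R.Weyl}
    (hi : ¬ (cs).IsLeftDescent w i) (hw : w = (cs).wordProd (altList j i p) * v)
    (hlen : (cs).length w = p + (cs).length v) (hm : R.coxeterMatrix i j ≠ 0) :
    p < R.coxeterMatrix i j := by
  by_contra! hp
  obtain ⟨r, rfl⟩ := Nat.exists_eq_add_of_le hp
  obtain ⟨i', j', he⟩ := altList_add j i (R.coxeterMatrix i j) r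
  rw [he, (cs).wordProd_append, ← R.wordProd_altList_comm h] at hw
  obtain ⟨m, hm'⟩ := Nat.exists_eq_succ_of_ne_zero hm
  apply hi
  have h1 : (cs).simple i * w =
      (cs).wordProd (altList j i m ++ altList i' j' r) * v := by
    rw [hw, hm', altList, (cs).wordProd_cons, (cs).wordProd_append]
    simp only [← mul_assoc, (cs).simple_mul_simple_self, one_mul]
  have h2 := (cs).length_mul_le ((cs).wordProd (altList j i m ++ altList i' j' r)) v
  have h3 := (cs).length_wordProd_le (altList j i m ++ altList i' j' r)
  rw [List.length_append, length_altList, length_altList] at h3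
  unfold CoxeterSystem.IsLeftDescent
  rw [h1]
  omega

/-- A two-term recursion, which reduces positivity in rank two to arithmetic of integer sequences.
-/
theorem act_altList_coroot (i j : I) (n : ℕ) (x : Module.Dual ℤ Qv) :
    R.act (altList j i (n + 2)) x (R.coroot i) =
      -R.a i j * R.act (altList i j (n + 1)) x (R.coroot j) -
        R.act (altList j i n) x (R.coroot i) := by
  rw [altList, act_cons, refl_apply_coroot, altList, act_cons, refl_apply_coroot_self]
  ring

theorem act_altList_one_coroot (i j : I) (x : Module.Dual ℤ Qv) :
    R.act (altList j i 1) x (R.coroot i) = x (R.coroot i) - R.a i j * x (R.coroot j) := by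
  rw [altList, act_cons, refl_apply_coroot]
  simp only [altList, act, List.foldr]
  ring

/-- Nonnegativity alone is not inductive for the recursion. The last two inequalities bound each
sequence below by a multiple of the other, and `aᵢⱼ aⱼᵢ ≥ 4` is exactly what reproduces them. -/
theorem act_altList_nonneg_of_four_le {i j : I} (h : i ≠ j) (h4 : 4 ≤ R.a i j * R.a j i)
    (x : Module.Dual ℤ Qv) (hi : 0 ≤ x (R.coroot i)) (hj : 0 ≤ x (R.coroot j)) (n : ℕ) :
    0 ≤ R.act (altList j i n) x (R.coroot i) ∧ 0 ≤ R.act (altList i j n) x (R.coroot j) ∧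
    -R.a i j * R.act (altList i j n) x (R.coroot j) ≤
      2 * R.act (altList j i (n + 1)) x (R.coroot i) ∧
    -R.a j i * R.act (altList j i n) x (R.coroot i) ≤
      2 * R.act (altList i j (n + 1)) x (R.coroot j) := by
  have h1 := R.a_nonpos i j h
  have h2 := R.a_nonpos j i h.symm
  induction n with
  | zero =>
    rw [zero_add, act_altList_one_coroot, act_altList_one_coroot]
    simp only [altList, act, List.foldr]
    refine ⟨hi, hj, ?_, ?_⟩ <;> nlinarith
  | succ n ih =>
    obtain ⟨hX, hY, hXY, hYX⟩ := ih
    rw [act_altList_coroot, act_altList_coroot]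
    refine ⟨by nlinarith, by nlinarith, ?_, ?_⟩
    · nlinarith [mul_le_mul_of_nonneg_left hYX (neg_nonneg.2 h1), mul_le_mul_of_nonneg_right h4 hX]
    · nlinarith [mul_le_mul_of_nonneg_left hXY (neg_nonneg.2 h2), mul_le_mul_of_nonneg_right h4 hY]

/-- For finite order `p` is at most 5, and unrolling the recursion leaves finitely many linear
inequalities. -/
theorem act_altList_nonneg {i j : I} (h : i ≠ j) (x : Module.Dual ℤ Qv)
    (hi : 0 ≤ x (R.coroot i)) (hj : 0 ≤ x (R.coroot j)) (p : ℕ)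
    (hp : R.coxeterMatrix i j ≠ 0 → p < R.coxeterMatrix i j) :
    0 ≤ R.act (altList j i p) x (R.coroot i) := by
  have e0 : R.act (altList j i 0) x (R.coroot i) = x (R.coroot i) := rfl
  have e0' : R.act (altList i j 0) x (R.coroot j) = x (R.coroot j) := rfl
  have e1 := R.act_altList_one_coroot i j x
  have e1' := R.act_altList_one_coroot j i x
  have e2 := R.act_altList_coroot i j 0 x
  have e2' := R.act_altList_coroot j i 0 x
  have e3 := R.act_altList_coroot i j 1 x
  have e3' := R.act_altList_coroot j i 1 x
  have e4 := R.act_altList_coroot i j 2 x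
  have e4' := R.act_altList_coroot j i 2 x
  have e5 := R.act_altList_coroot i j 3 x
  norm_num only at e2 e2' e3 e3' e4 e4' e5
  rcases R.coxeter_cases h with h | h | h | h | h | h | h'
  iterate 6
    obtain ⟨hm, hij, hji⟩ := h
    rw [hm] at hp
    have := hp (by norm_num)
    rw [hij] at e1 e2 e3 e4 e5
    rw [hji] at e1' e2' e3' e4'
    clear hm hij hji hp
    interval_cases p <;> linarith
  exact (R.act_altList_nonneg_of_four_le h h'.2 x hi hj p).1

/-- If `ℓ(sᵢ w) > ℓ(w)`, then `w⁻¹(αᵢ^∨)` is nonnegative on dominant weights. -/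
theorem weylRep_coroot_nonneg (n : ℕ) : ∀ (w : R.Weyl) (i : I), (cs).length w = n →
    ¬ (cs).IsLeftDescent w i → ∀ x : Module.Dual ℤ Qv, R.IsDominant x →
      0 ≤ R.weylRep w x (R.coroot i) := by
  induction n using Nat.strong_induction_on with
  | _ n ih =>
    intro w i hw hi x hx
    by_cases h1 : w = 1
    · subst h1
      simpa using hx i
    obtain ⟨j, hj⟩ := (cs).exists_leftDescent_of_ne_one h1
    have hij : i ≠ j := by rintro rfl; exact hi hj
    -- Reduction to rank two: `v` is shorter than `w` and has neither descent, so induction makes `v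
    -- x` nonnegative on both coroots.
    obtain ⟨p, v, hwv, hlen, hvi, hvj⟩ := R.exists_altList_mul _ i j w rfl hi
    have hp : p ≠ 0 := by
      rintro rfl
      have : w = v := by rw [hwv]; simp [altList]
      exact hvj (this ▸ hj)
    have hlt := R.altList_length_lt hij hi hwv hlen
    have hI := ih _ (by omega) v i rfl hvi x hx
    have hJ := ih _ (by omega) v j rfl hvj x hx
    rw [hwv, map_mul, Module.End.mul_apply, ← act_eq_weylRep]
    exact R.act_altList_nonneg hij _ hI hJ p hlt

/-- Applied to `lam + ρ`, this says that the exponents occurring in `F_{w,lam}` are nonnegative. -/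
theorem act_coroot_nonneg {i : I} {l : List I} (hl : (cs).IsReduced (i :: l))
    {x : Module.Dual ℤ Qv} (hx : R.IsDominant x) : 0 ≤ R.act l x (R.coroot i) := by
  rw [act_eq_weylRep]
  refine R.weylRep_coroot_nonneg _ _ i rfl ?_ x hx
  have h1 : (cs).length ((cs).simple i * (cs).wordProd l) = l.length + 1 := by
    rw [← (cs).wordProd_cons]; exact hl
  have h2 := (cs).length_wordProd_le l
  unfold CoxeterSystem.IsLeftDescent
  omega

end Weyl

end CartanData

/-! ### The map to the localization, and families of weights. -/

section LocalizationMap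

variable (k : Type*) [Field k] {I : Type*} {A : Type*} [Ring A] [Algebra k A] (f : I → A)

/-- The canonical map `A → Ã` as an algebra homomorphism. -/
def toLocHom : A →ₐ[k] Loc k f where
  toFun := toLoc k f
  map_one' := by
    have h := RingQuot.mkAlgHom_rel k (LocRel.scalar (k := k) (f := f) 1)
    rw [map_one, map_one, map_one] at h
    exact h
  map_mul' x y := by
    have h := RingQuot.mkAlgHom_rel k (LocRel.mul (k := k) (f := f) x y)
    rw [map_mul] at h
    exact h
  map_zero' := by
    have h := RingQuot.mkAlgHom_rel k (LocRel.scalar (k := k) (f := f) 0)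
    rw [map_zero, map_zero, map_zero] at h
    exact h
  map_add' x y := by
    have h := RingQuot.mkAlgHom_rel k (LocRel.add (k := k) (f := f) x y)
    rw [map_add] at h
    exact h
  commutes' c := by
    have h := RingQuot.mkAlgHom_rel k (LocRel.scalar (k := k) (f := f) c)
    rw [AlgHom.commutes] at h
    exact h

theorem toLocHom_apply (x : A) : toLocHom k f x = toLoc k f x := rfl

theorem fUnit_val (i : I) : ((fUnit k f i : (Loc k f)ˣ) : Loc k f) = toLoc k f (f i) := rfl

end LocalizationMap

section WeightFunctions

variable {Qv : Type*} [AddCommGroup Qv] {S : Type*}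

theorem WeightFun.mul_apply [Ring S] (a b : WeightFun Qv S) (lam : Module.Dual ℤ Qv) :
    (a * b) lam = a lam * b lam := rfl

theorem WeightFun.smul_apply [Ring S] (a : WeightFun Qv S) (mu : Multiplicative (Module.Dual ℤ Qv))
    (lam : Module.Dual ℤ Qv) : (mu • a) lam = a (lam + mu.toAdd) := rfl

theorem ofFun_mul_tauMon [Ring S] (a : WeightFun Qv S) (mu : Module.Dual ℤ Qv) :
    ofFun a * tauMon mu = SkewMonoidAlgebra.single (Multiplicative.ofAdd mu) a := by
  rw [ofFun, tauMon, SkewMonoidAlgebra.single_mul_single, one_mul, smul_one, mul_one]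

/-- The pullback of a family along a simple reflection. -/
def reflFun {I : Type*} [DecidableEq I] (R : CartanData I Qv) (i : I) (a : WeightFun Qv S) :
    WeightFun Qv S := fun lam => a (R.refl i lam)

theorem tildeRefl_single {I : Type*} [DecidableEq I] (R : CartanData I Qv) [Ring S] (i : I)
    (mu : Module.Dual ℤ Qv) (a : WeightFun Qv S) :
    tildeRefl R i (SkewMonoidAlgebra.single (Multiplicative.ofAdd mu) a) =
      SkewMonoidAlgebra.single (Multiplicative.ofAdd (R.refl i mu)) (reflFun R i a) := by
  unfold tildeRefl
  rw [SkewMonoidAlgebra.sum_single_index]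
  · rfl
  · exact SkewMonoidAlgebra.single_zero _

end WeightFunctions

/-! ### Coefficients of quantum `τ`-functions and their special values. -/

section TauCoefficient

variable {I : Type*} [DecidableEq I] {Qv : Type*} [AddCommGroup Qv] (R : CartanData I Qv)
variable (k : Type*) [Field k] {A : Type*} [Ring A] [Algebra k A] (f : I → A)

/-- The coefficient of the quantum `τ`-function `w(τ^μ)` at `τ^{w(μ)}`. -/
def tauCoeff (mu : Module.Dual ℤ Qv) : List I → WeightFun Qv (Loc k f)
  | [] => 1
  | i :: l => fun lam => ((fUnit k f i ^ lam (R.coroot i) : (Loc k f)ˣ) : Loc k f) *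
      tauCoeff mu l (R.refl i lam) *
      ((fUnit k f i ^ (-(lam + R.act (i :: l) mu) (R.coroot i)) : (Loc k f)ˣ) : Loc k f)

/-- Moving `fᵢ^{-αᵢ^∨}` to the left across `τ^{w(μ)}` translates its argument by `w(μ)`; this is the
shift in the last exponent of `tauCoeff`. -/
theorem tauFun_eq_single (mu : Module.Dual ℤ Qv) (l : List I) :
    tauFun R k f l mu =
      SkewMonoidAlgebra.single (Multiplicative.ofAdd (R.act l mu)) (tauCoeff R k f mu l) := by
  induction l with
  | nil => rfl
  | cons i l ih =>
    change birRefl R k f i (tauFun R k f l mu) = _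
    rw [ih, birRefl, tildeRefl_single, ofFun, ofFun, SkewMonoidAlgebra.single_mul_single,
      SkewMonoidAlgebra.single_mul_single, one_mul, mul_one, one_smul]
    congr 1
    funext lam
    simp only [WeightFun.mul_apply, WeightFun.smul_apply, fracPow, tauCoeff, map_neg]
    rfl

theorem tauFun_eq (mu : Module.Dual ℤ Qv) (l : List I) :
    tauFun R k f l mu = ofFun (tauCoeff R k f mu l) * tauMon (R.act l mu) := by
  rw [tauFun_eq_single, ofFun_mul_tauMon]

/-- The product `⋯ f_{i₂}^{⟨α_{i₂}^∨, s_{i₁} ν⟩} f_{i₁}^{⟨α_{i₁}^∨, ν⟩}` in the unit group of `Ã`. -/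
def singUnit (nu : Module.Dual ℤ Qv) : List I → (Loc k f)ˣ
  | [] => 1
  | i :: l => fUnit k f i ^ (R.act l nu (R.coroot i)) * singUnit nu l

theorem act_add (l : List I) (x y : Module.Dual ℤ Qv) :
    R.act l (x + y) = R.act l x + R.act l y := by
  rw [R.act_eq_weylRep, R.act_eq_weylRep, R.act_eq_weylRep, map_add]

theorem act_neg (l : List I) (x : Module.Dual ℤ Qv) : R.act l (-x) = -R.act l x := by
  rw [R.act_eq_weylRep, R.act_eq_weylRep, map_neg]

/-- At this weight the powers on the left assemble the product for `ν + μ`, while those on the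
right, shifted by `w(μ)`, assemble the inverse of the product for `ν`. The minus sign compensates
for each reflection negating its own coroot. -/
theorem tauCoeff_act (mu nu : Module.Dual ℤ Qv) (l : List I) :
    tauCoeff R k f mu l (-R.act l (nu + mu)) =
      ((singUnit R k f (nu + mu) l * (singUnit R k f nu l)⁻¹ : (Loc k f)ˣ) : Loc k f) := by
  induction l with
  | nil => simp [tauCoeff, singUnit]; rfl
  | cons i l ih =>
    have h1 : R.refl i (-R.act (i :: l) (nu + mu)) = -R.act l (nu + mu) := by
      rw [R.act_cons, ← R.reflEnd_apply, map_neg, R.reflEnd_apply, R.refl_refl]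
    have h2 : (-R.act (i :: l) (nu + mu)) (R.coroot i) = R.act l (nu + mu) (R.coroot i) := by
      rw [R.act_cons, LinearMap.neg_apply, R.refl_apply_coroot_self, neg_neg]
    have h3 : (-R.act (i :: l) (nu + mu) + R.act (i :: l) mu) (R.coroot i) =
        R.act l nu (R.coroot i) := by
      rw [act_add, neg_add, neg_add_cancel_right, LinearMap.neg_apply, R.act_cons,
        R.refl_apply_coroot_self, neg_neg]
    simp only [tauCoeff]
    rw [h1, h2, ih, h3, ← Units.val_mul, ← Units.val_mul]
    congr 1
    simp only [singUnit, mul_inv_rev, zpow_neg, mul_assoc]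

variable [Fintype I]

theorem rho_coroot (i : I) : R.rho (R.coroot i) = 1 := by
  simp [CartanData.rho, R.fund_coroot]

theorem isDominant_add_rho {lam : Module.Dual ℤ Qv} (h : R.IsDominant lam) :
    R.IsDominant (lam + R.rho) := by
  intro i
  rw [LinearMap.add_apply, rho_coroot]
  linarith [h i]

/-- The `+ 1` in each exponent absorbs the `-ρ` of the shifted action, and positivity on reduced
words ensures that `toNat` truncates nothing. -/
theorem toLoc_singF {l : List I} (hl : R.coxeterMatrix.toCoxeterSystem.IsReduced l)
    {lam : Module.Dual ℤ Qv} (h : R.IsDominant lam) :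
    toLoc k f (singF R f l lam) = (singUnit R k f (lam + R.rho) l : (Loc k f)ˣ) := by
  induction l with
  | nil => exact map_one (toLocHom k f)
  | cons i l ih =>
    have h0 := R.act_coroot_nonneg hl (isDominant_add_rho R h)
    have h1 : R.dotAct l lam (R.coroot i) + 1 = R.act l (lam + R.rho) (R.coroot i) := by
      rw [CartanData.dotAct, LinearMap.sub_apply, rho_coroot, sub_add_cancel]
    rw [singF, singUnit, ← toLocHom_apply, map_mul, map_pow, toLocHom_apply, toLocHom_apply,
      ih (hl.drop 1), h1, Units.val_mul, ← fUnit_val]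
    congr 1
    obtain ⟨n, hn⟩ := Int.eq_ofNat_of_zero_le h0
    rw [hn, Int.toNat_natCast, zpow_natCast, Units.val_pow_eq_pow_val]

/-- The special values of the coefficient of a quantum `τ`-function lie in the image of `A`. -/
theorem tauCoeff_act_mem {l : List I} (hl : R.coxeterMatrix.toCoxeterSystem.IsReduced l)
    {lam mu : Module.Dual ℤ Qv} (hlam : R.IsDominant lam) (hmu : R.IsDominant mu) {u : A}
    (hu : singF R f l (lam + mu) = u * singF R f l lam) :
    tauCoeff R k f mu l (-R.act l (lam + R.rho + mu)) = toLoc k f u := by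
  have hdom : R.IsDominant (lam + mu) := fun i => add_nonneg (hlam i) (hmu i)
  have h := congrArg (toLocHom k f) hu
  rw [map_mul, toLocHom_apply, toLocHom_apply, toLocHom_apply, toLoc_singF R k f hl hdom,
    toLoc_singF R k f hl hlam, add_right_comm] at h
  rw [tauCoeff_act, Units.val_mul, h, mul_assoc, Units.mul_inv, mul_one]

end TauCoefficient

/-! ### Families with scalar-function coefficients, and descent to a subspace. -/

section MixedFamilies

open scoped TensorProduct

variable {k : Type*} [Field k] {Qv : Type*} [AddCommGroup Qv] {S : Type*} [Ring S] [Algebra k S]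

variable (k Qv S) in
/-- Constant families, as an algebra homomorphism. -/
def constHom : S →ₐ[k] WeightFun Qv S := Pi.constAlgHom k (Module.Dual ℤ Qv) S

theorem constHom_apply (x : S) : constHom k Qv S x = constFun x := rfl

variable (k Qv S) in
/-- Scalar families, as an algebra homomorphism. -/
def scalarHom : (Module.Dual ℤ Qv → k) →ₐ[k] WeightFun Qv S :=
  (Algebra.ofId k S).compLeft (Module.Dual ℤ Qv)

theorem scalarHom_apply (b : Module.Dual ℤ Qv → k) (lam : Module.Dual ℤ Qv) :
    scalarHom k Qv S b lam = algebraMap k S (b lam) := rfl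

theorem scalarHom_mul_constHom_apply (b : Module.Dual ℤ Qv → k) (x : S) (lam : Module.Dual ℤ Qv) :
    (scalarHom k Qv S b * constHom k Qv S x) lam = b lam • x :=
  (Algebra.smul_def _ _).symm

theorem commute_scalarHom_constHom (b : Module.Dual ℤ Qv → k) (x : S) :
    Commute (scalarHom k Qv S b) (constHom k Qv S x) :=
  funext fun _ => Algebra.commutes _ _

/-- The families `∑ bᵢ xᵢ` with constants `xᵢ` and scalar families `bᵢ` in `B`. -/
def mixedHom (B : Subalgebra k (Module.Dual ℤ Qv → k)) : B ⊗[k] S →ₐ[k] WeightFun Qv S :=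
  Algebra.TensorProduct.lift ((scalarHom k Qv S).comp B.val) (constHom k Qv S) fun b x =>
    commute_scalarHom_constHom b.1 x

theorem mixedHom_tmul_apply (B : Subalgebra k (Module.Dual ℤ Qv → k)) (b : B) (x : S)
    (lam : Module.Dual ℤ Qv) : mixedHom B (b ⊗ₜ[k] x) lam = b.1 lam • x := by
  have h := Algebra.TensorProduct.lift_tmul ((scalarHom k Qv S).comp B.val) (constHom k Qv S)
    (fun b x => commute_scalarHom_constHom b.1 x) b x
  exact (congrFun h lam).trans (scalarHom_mul_constHom_apply _ _ _)

variable {B : Subalgebra k (Module.Dual ℤ Qv → k)}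

theorem constHom_mem_mixed (x : S) : constHom k Qv S x ∈ (mixedHom (S := S) B).range :=
  ⟨1 ⊗ₜ x, by
    funext lam
    exact (mixedHom_tmul_apply B 1 x lam).trans (one_smul k x)⟩

theorem scalarHom_mem_mixed {b : Module.Dual ℤ Qv → k} (hb : b ∈ B) :
    scalarHom k Qv S b ∈ (mixedHom (S := S) B).range :=
  ⟨⟨b, hb⟩ ⊗ₜ 1, by
    funext lam
    exact (mixedHom_tmul_apply B ⟨b, hb⟩ 1 lam).trans (Algebra.algebraMap_eq_smul_one _).symm⟩

/-- A functional turns `∑ bₘ xₘ` into `∑ ψ(xₘ) bₘ`, so vanishing of such families can be tested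
inside `B`. -/
theorem dual_mixedHom_mem (psi : S →ₗ[k] k) (t : B ⊗[k] S) :
    (fun lam => psi (mixedHom B t lam)) ∈ B := by
  induction t using TensorProduct.induction_on with
  | zero =>
    have : (fun lam => psi (mixedHom B (0 : B ⊗[k] S) lam)) = 0 := by
      funext lam
      rw [map_zero]
      exact map_zero psi
    rw [this]
    exact zero_mem B
  | tmul b x =>
    have : (fun lam => psi (mixedHom B (b ⊗ₜ[k] x) lam)) = psi x • b.1 := by
      funext lam
      rw [mixedHom_tmul_apply, map_smul, Pi.smul_apply, smul_eq_mul, smul_eq_mul, mul_comm]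
    rw [this]
    exact B.smul_mem b.2 _
  | add s t hs ht =>
    have : (fun lam => psi (mixedHom B (s + t) lam)) =
        (fun lam => psi (mixedHom B s lam)) + fun lam => psi (mixedHom B t lam) := by
      funext lam
      rw [map_add]
      exact map_add psi _ _
    rw [this]
    exact add_mem hs ht

/-- A family in the mixed algebra whose values on a set of uniqueness for `B` lie in a subspace
has coefficients in that subspace. -/
theorem mem_of_mixed {D : Set (Module.Dual ℤ Qv)}
    (hD : ∀ b ∈ B, (∀ lam ∈ D, b lam = 0) → b = 0) (V : Submodule k S)
    {T : Subalgebra k (WeightFun Qv S)} (hB : ∀ b ∈ B, scalarHom k Qv S b ∈ T)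
    (hV : ∀ x ∈ V, constHom k Qv S x ∈ T) {g : WeightFun Qv S}
    (hg : g ∈ (mixedHom (S := S) B).range) (hgD : ∀ lam ∈ D, g lam ∈ V) : g ∈ T := by
  -- Over a field the subspace has a linear projection `P`; it need not respect products.
  obtain ⟨p, hp⟩ := V.subtype.exists_leftInverse_of_injective (LinearMap.ker_eq_bot.2
    Subtype.val_injective)
  let P : S →ₗ[k] S := V.subtype ∘ₗ p
  have hP : ∀ x ∈ V, P x = x := fun x hx =>
    congrArg Subtype.val (LinearMap.congr_fun hp (⟨x, hx⟩ : V))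
  obtain ⟨t, rfl⟩ := hg
  -- Every functional of `g - P g` lies in `B` and vanishes on `D`, hence is zero, and functionals
  -- separate points.
  have key : mixedHom B t = (fun lam => P (mixedHom B t lam) : WeightFun Qv S) := by
    funext lam
    rw [← sub_eq_zero, ← Module.forall_dual_apply_eq_zero_iff k]
    intro psi
    have h := dual_mixedHom_mem (psi ∘ₗ (LinearMap.id - P)) t
    have h0 := hD _ h fun mu hmu => by
      have e : P (mixedHom B t mu) = mixedHom B t mu := hP _ (hgD mu hmu)
      change psi (mixedHom B t mu - P (mixedHom B t mu)) = 0
      rw [e, sub_self, map_zero]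
    exact congrFun h0 lam
  -- Applying `P` replaces each coefficient `xₘ` by `P xₘ`, an element of `V`.
  have hmem : ∀ t : B ⊗[k] S, (fun lam => P (mixedHom B t lam) : WeightFun Qv S) ∈ T := by
    intro t
    induction t using TensorProduct.induction_on with
    | zero =>
      have : (fun lam => P (mixedHom B (0 : B ⊗[k] S) lam) : WeightFun Qv S) = 0 := by
        funext lam
        rw [map_zero]
        exact map_zero P
      rw [this]
      exact zero_mem T
    | tmul b x =>
      have : (fun lam => P (mixedHom B (b ⊗ₜ[k] x) lam) : WeightFun Qv S) =
          scalarHom k Qv S b.1 * constHom k Qv S (P x) := by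
        funext lam
        rw [mixedHom_tmul_apply, map_smul]
        exact (scalarHom_mul_constHom_apply _ _ _).symm
      rw [this]
      exact mul_mem (hB _ b.2) (hV _ (p x).2)
    | add s t hs ht =>
      have : (fun lam => P (mixedHom B (s + t) lam) : WeightFun Qv S) =
          (fun lam => P (mixedHom B s lam) : WeightFun Qv S) +
            (fun lam => P (mixedHom B t lam) : WeightFun Qv S) := by
        funext lam
        rw [map_add]
        exact map_add P _ _
      rw [this]
      exact add_mem hs ht
  have h := hmem t
  rw [← key] at h
  exact h

end MixedFamilies

/-! ### The induction proving regularity. -/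

section Regularity

variable {I : Type*} [DecidableEq I] {Qv : Type*} [AddCommGroup Qv] (R : CartanData I Qv)
variable (k : Type*) [Field k] {A : Type*} [Ring A] [Algebra k A] (f : I → A)

/-- Conjugation by the fractional power `fᵢ^{αᵢ^∨}`, composed with the reflection of weights. -/
def conjRefl (i : I) : WeightFun Qv (Loc k f) →ₐ[k] WeightFun Qv (Loc k f) where
  toFun g := fun lam => ((fUnit k f i ^ lam (R.coroot i) : (Loc k f)ˣ) : Loc k f) *
    g (R.refl i lam) * (((fUnit k f i ^ lam (R.coroot i))⁻¹ : (Loc k f)ˣ) : Loc k f)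
  map_one' := by
    funext lam
    exact (congrArg (· * _) (mul_one _)).trans (Units.mul_inv _)
  map_mul' a b := by
    have e : ∀ (u : (Loc k f)ˣ) (x y : Loc k f), (u : Loc k f) * (x * y) * (u⁻¹ : (Loc k f)ˣ) =
        (u * x * (u⁻¹ : (Loc k f)ˣ)) * (u * y * (u⁻¹ : (Loc k f)ˣ)) := fun u x y => by
      simp only [mul_assoc, Units.inv_mul_cancel_left]
    exact funext fun lam => e _ _ _
  map_zero' := by
    funext lam
    exact (congrArg (· * _) (mul_zero _)).trans (zero_mul _)
  map_add' a b := by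
    funext lam
    exact (congrArg (· * _) (mul_add _ _ _)).trans (add_mul _ _ _)
  commutes' c := by
    funext lam
    change _ * algebraMap k (Loc k f) c * _ = algebraMap k (Loc k f) c
    rw [← Algebra.commutes, mul_assoc, Units.mul_inv, mul_one]

theorem conjRefl_apply (i : I) (g : WeightFun Qv (Loc k f)) (lam : Module.Dual ℤ Qv) :
    conjRefl R k f i g lam = ((fUnit k f i ^ lam (R.coroot i) : (Loc k f)ˣ) : Loc k f) *
    g (R.refl i lam) * (((fUnit k f i ^ lam (R.coroot i))⁻¹ : (Loc k f)ˣ) : Loc k f) := rfl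

/-- The right-hand power is split into the inverse of the left-hand one and a power independent of
the weight. That constant may be a negative power of `fᵢ`, so it lies only in the localization. -/
theorem tauCoeff_cons (mu : Module.Dual ℤ Qv) (i : I) (l : List I) :
    tauCoeff R k f mu (i :: l) = conjRefl R k f i (tauCoeff R k f mu l) *
      constHom k Qv (Loc k f)
        ((fUnit k f i ^ (-R.act (i :: l) mu (R.coroot i)) : (Loc k f)ˣ) : Loc k f) := by
  funext lam
  rw [WeightFun.mul_apply, conjRefl_apply, constHom_apply, constFun, mul_assoc, ← Units.val_mul,
    ← zpow_neg, ← zpow_add, ← neg_add]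
  rfl

/-- The properties of an algebra `B` of functions on the weight lattice, generated by the
parameter variables attached to the simple coroots, on which regularity rests. -/
structure IsParameterAlgebra (prm : Qv → WeightFun Qv (Loc k f))
    (B : Subalgebra k (Module.Dual ℤ Qv → k)) : Prop where
  scalar_mem : ∀ b ∈ B, scalarHom k Qv (Loc k f) b ∈ polyAlg R k f prm
  coroot_mem : ∀ i, ∃ b ∈ B, prm (R.coroot i) = scalarHom k Qv (Loc k f) b
  neg_coroot_mem : ∀ i, ∃ b ∈ B, prm (-R.coroot i) = scalarHom k Qv (Loc k f) b
  refl_mem : ∀ b ∈ B, ∀ i, (fun lam => b (R.refl i lam)) ∈ B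
  neg_add_mem : ∀ b ∈ B, ∀ c, (fun lam => b (-lam + c)) ∈ B
  eq_zero : ∀ b ∈ B, (∀ lam, R.IsDominant lam → b lam = 0) → b = 0
  conj_mem : ∀ i j, (fun lam => ((fUnit k f i ^ lam (R.coroot i) : (Loc k f)ˣ) : Loc k f) *
    toLoc k f (f j) * (((fUnit k f i ^ lam (R.coroot i))⁻¹ : (Loc k f)ˣ) : Loc k f) :
      WeightFun Qv (Loc k f)) ∈ (mixedHom (S := Loc k f) B).range

variable {R k f} {prm : Qv → WeightFun Qv (Loc k f)} {B : Subalgebra k (Module.Dual ℤ Qv → k)}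

variable (R) in
theorem act_surjective (l : List I) : Function.Surjective (R.act l) := by
  induction l with
  | nil => exact fun x => ⟨x, rfl⟩
  | cons i l ih =>
    intro x
    obtain ⟨y, hy⟩ := ih (R.refl i x)
    exact ⟨y, by rw [R.act_cons, hy, R.refl_refl]⟩

theorem polyAlg_le_paramAlg : polyAlg R k f prm ≤ paramAlg k f prm := by
  refine Algebra.adjoin_mono (Set.union_subset_union ?_ (Set.union_subset ?_ ?_))
  · rintro _ ⟨i, rfl⟩
    exact ⟨f i, rfl⟩
  · rintro _ ⟨i, rfl⟩
    exact ⟨R.coroot i, rfl⟩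
  · rintro _ ⟨i, rfl⟩
    exact ⟨-R.coroot i, rfl⟩

theorem constHom_toLoc_mem (hgen : Algebra.adjoin k (Set.range f) = ⊤) (x : A) :
    constHom k Qv (Loc k f) (toLoc k f x) ∈ polyAlg R k f prm := by
  have h : Algebra.adjoin k (Set.range f) ≤
      (polyAlg R k f prm).comap ((constHom k Qv (Loc k f)).comp (toLocHom k f)) := by
    refine Algebra.adjoin_le ?_
    rintro _ ⟨i, rfl⟩
    exact Algebra.subset_adjoin (.inl ⟨i, rfl⟩)
  rw [hgen] at h
  exact h (Algebra.mem_top (x := x))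

namespace IsParameterAlgebra

variable (h : IsParameterAlgebra R k f prm B)
include h

/-- Conjugation is an algebra homomorphism, so generators suffice: scalar families are merely
reflected, and the `fⱼ` are covered by `conj_mem`. -/
theorem conjRefl_mem (i : I) {g : WeightFun Qv (Loc k f)} (hg : g ∈ polyAlg R k f prm) :
    conjRefl R k f i g ∈ (mixedHom (S := Loc k f) B).range := by
  have hscalar : ∀ b ∈ B, conjRefl R k f i (scalarHom k Qv (Loc k f) b) ∈
      (mixedHom (S := Loc k f) B).range := by
    intro b hb
    have : conjRefl R k f i (scalarHom k Qv (Loc k f) b) =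
        scalarHom k Qv (Loc k f) (fun lam => b (R.refl i lam)) := by
      funext lam
      rw [conjRefl_apply, scalarHom_apply, scalarHom_apply, ← Algebra.commutes, mul_assoc,
        Units.mul_inv, mul_one]
    rw [this]
    exact scalarHom_mem_mixed (h.refl_mem b hb i)
  have hle : polyAlg R k f prm ≤ (mixedHom (S := Loc k f) B).range.comap (conjRefl R k f i) := by
    refine Algebra.adjoin_le (Set.union_subset ?_ (Set.union_subset ?_ ?_))
    · rintro _ ⟨j, rfl⟩
      exact h.conj_mem i j
    · rintro _ ⟨j, rfl⟩
      obtain ⟨b, hb, e⟩ := h.coroot_mem j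
      have h1 := hscalar b hb
      rw [← e] at h1
      exact h1
    · rintro _ ⟨j, rfl⟩
      obtain ⟨b, hb, e⟩ := h.neg_coroot_mem j
      have h1 := hscalar b hb
      rw [← e] at h1
      exact h1
  exact hle hg

theorem act_mem (l : List I) : ∀ b ∈ B, (fun lam => b (R.act l lam)) ∈ B := by
  induction l with
  | nil => exact fun b hb => hb
  | cons i l ih => exact fun b hb => ih _ (h.refl_mem b hb i)

/-- The weights `-w(lam + c)` with `lam` dominant still form a set of uniqueness, because `B` is
stable under reflections, negation and translations. -/
theorem eq_zero_of_act (l : List I) (c : Module.Dual ℤ Qv) {b : Module.Dual ℤ Qv → k} (hb : b ∈ B)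
    (h0 : ∀ lam, R.IsDominant lam → b (-R.act l (lam + c)) = 0) : b = 0 := by
  have h1 := h.eq_zero _ (h.neg_add_mem _ (h.act_mem l b hb) (-c)) fun lam hlam => by
    rw [← neg_add, act_neg]
    exact h0 lam hlam
  funext lam
  obtain ⟨y, rfl⟩ := act_surjective R l lam
  have h2 := congrFun h1 (-y - c)
  rwa [neg_sub, sub_neg_eq_add, add_comm c y, add_neg_cancel_right] at h2

variable [Fintype I]

/-- Induction on the word. Polynomiality for the tail gives an expansion with coefficients in the
localization; the special values, which lie in the image of `A`, then force the coefficients into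
that image. -/
theorem tauCoeff_mem (hgen : Algebra.adjoin k (Set.range f) = ⊤)
    (hF : ∀ lam mu : Module.Dual ℤ Qv, R.IsDominant lam → R.IsDominant mu →
      ∀ (w : R.Weyl) (l : List I), R.IsReducedExpr w l →
        ∃ u : A, singF R f l (lam + mu) = u * singF R f l lam)
    {mu : Module.Dual ℤ Qv} (hmu : R.IsDominant mu) {l : List I}
    (hl : R.coxeterMatrix.toCoxeterSystem.IsReduced l) :
    tauCoeff R k f mu l ∈ polyAlg R k f prm := by
  induction l with
  | nil => exact one_mem (polyAlg R k f prm)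
  | cons i l ih =>
    refine mem_of_mixed (B := B)
      (D := {x | ∃ lam, R.IsDominant lam ∧ x = -R.act (i :: l) (lam + (R.rho + mu))})
      (fun b hb h0 => h.eq_zero_of_act (i :: l) (R.rho + mu) hb fun lam hlam =>
        h0 _ ⟨lam, hlam, rfl⟩)
      (LinearMap.range (toLocHom k f).toLinearMap) h.scalar_mem ?_ ?_ ?_
    · rintro _ ⟨x, rfl⟩
      exact constHom_toLoc_mem hgen x
    · rw [tauCoeff_cons]
      exact mul_mem (h.conjRefl_mem i (ih (hl.drop 1))) (constHom_mem_mixed _)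
    · rintro _ ⟨lam, hlam, rfl⟩
      obtain ⟨u, hu⟩ := hF lam mu hlam hmu _ _ ⟨rfl, hl⟩
      rw [← add_assoc, tauCoeff_act_mem R k f hl hlam hmu hu]
      exact ⟨u, rfl⟩

theorem isRegular (hgen : Algebra.adjoin k (Set.range f) = ⊤)
    (hF : ∀ lam mu : Module.Dual ℤ Qv, R.IsDominant lam → R.IsDominant mu →
      ∀ (w : R.Weyl) (l : List I), R.IsReducedExpr w l →
        ∃ u : A, singF R f l (lam + mu) = u * singF R f l lam)
    {mu : Module.Dual ℤ Qv} (hmu : R.IsDominant mu) {w : R.Weyl} {l : List I}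
    (hl : R.IsReducedExpr w l) :
    IsRegular R k f prm (R.act l mu) (tauFun R k f l mu) :=
  have hmem := h.tauCoeff_mem hgen hF hmu hl.2
  ⟨tauCoeff R k f mu l, polyAlg_le_paramAlg hmem, hmem, tauFun_eq R k f mu l⟩

end IsParameterAlgebra

end Regularity

/-! ### Integer powers of conjugation by a unit. -/

section Conjugation

variable (k : Type*) [Field k] {S : Type*} [Ring S] [Algebra k S] (u : Sˣ)

/-- Conjugation by a unit as a linear endomorphism. -/
def conjEnd : Module.End k S :=
  LinearMap.mulLeft k (u : S) * LinearMap.mulRight k ((u⁻¹ : Sˣ) : S)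

theorem conjEnd_apply (x : S) : conjEnd k u x = u * x * (u⁻¹ : Sˣ) := by
  simp [conjEnd, mul_assoc]

theorem conjEnd_conj_zpow (n : ℤ) (x : S) :
    conjEnd k u ((u ^ n : Sˣ) * x * ((u ^ n)⁻¹ : Sˣ)) =
      (u ^ (n + 1) : Sˣ) * x * ((u ^ (n + 1))⁻¹ : Sˣ) := by
  rw [conjEnd_apply, add_comm, zpow_one_add, mul_inv_rev]
  simp only [Units.val_mul, mul_assoc]

theorem conjEnd_pow_apply (n : ℕ) (x : S) :
    (conjEnd k u ^ n) x = u ^ n * x * ((u⁻¹ : Sˣ) : S) ^ n := by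
  induction n with
  | zero => simp
  | succ n ih =>
    rw [pow_succ', Module.End.mul_apply, ih, conjEnd_apply, pow_succ', pow_succ]
    simp only [mul_assoc]

theorem conjEnd_injective : Function.Injective (conjEnd k u) := by
  intro x y h
  rw [conjEnd_apply, conjEnd_apply] at h
  simpa using h

/-- A family `n ↦ h n` compatible with conjugation computes `uⁿ x u⁻ⁿ`. -/
theorem conj_zpow_eq_of_step {x : S} {h : ℤ → S} (h0 : h 0 = x)
    (hstep : ∀ n, h (n + 1) = conjEnd k u (h n)) (n : ℤ) :
    (u ^ n : Sˣ) * x * ((u ^ n)⁻¹ : Sˣ) = h n := by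
  induction n using Int.induction_on with
  | zero => simp [h0]
  | succ n ih => rw [hstep, ← ih, conjEnd_conj_zpow]
  -- Downward steps use that conjugation is injective.
  | pred n ih =>
    apply conjEnd_injective k u
    rw [← hstep, sub_add_cancel, ← ih, conjEnd_conj_zpow, sub_add_cancel]

/-- If the commutator with `u` is nilpotent at `x`, then so is conjugation minus the identity. -/
theorem conjEnd_sub_one_pow_apply {N : ℕ} {x : S}
    (h : ((LinearMap.mulLeft k (u : S) - LinearMap.mulRight k (u : S)) ^ N) x = 0) :
    ((conjEnd k u - 1) ^ N) x = 0 := by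
  have hc : Commute (LinearMap.mulLeft k (u : S)) (LinearMap.mulRight k ((u⁻¹ : Sˣ) : S)) :=
    LinearMap.commute_mulLeft_right _ _
  have hr : Commute (LinearMap.mulRight k (u : S)) (LinearMap.mulRight k ((u⁻¹ : Sˣ) : S)) := by
    refine LinearMap.ext fun y => ?_
    simp [mul_assoc]
  -- Conjugation minus the identity is the commutator followed by right multiplication by `u⁻¹`;
  -- these commute, so the power splits.
  have he : conjEnd k u - 1 = LinearMap.mulRight k ((u⁻¹ : Sˣ) : S) *
      (LinearMap.mulLeft k (u : S) - LinearMap.mulRight k (u : S)) := by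
    refine LinearMap.ext fun y => ?_
    simp [conjEnd_apply, sub_mul, mul_assoc]
  rw [he, ((hc.sub_left hr).symm).mul_pow, Module.End.mul_apply, h, map_zero]

/-- Newton's expansion of `(1 + (C - 1))ⁿ`, with `C` the conjugation, breaks off by nilpotency.
Pascal's rule is the step in `n`, so negative `n` are included, and the descending factorials
display polynomial dependence on `n`. -/
theorem conj_zpow_eq_sum_choose [CharZero k] {N : ℕ} {x : S}
    (h : ((conjEnd k u - 1) ^ N) x = 0) (n : ℤ) :
    (u ^ n : Sˣ) * x * ((u ^ n)⁻¹ : Sˣ) =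
      ∑ m ∈ Finset.range (N + 1), ((m.factorial : k)⁻¹ • (descPochhammer ℤ m).smeval (n : k)) •
        ((conjEnd k u - 1) ^ m) x := by
  simp only [← Ring.choose_eq_smul]
  refine conj_zpow_eq_of_step k u (h := fun n : ℤ =>
    ∑ m ∈ Finset.range (N + 1), Ring.choose (n : k) m • ((conjEnd k u - 1) ^ m) x) ?_ ?_ n
  · simp [Finset.sum_range_succ']
  · intro n
    have hS : ∀ y : S, conjEnd k u y = y + (conjEnd k u - 1) y := fun y => by simp
    rw [hS, map_sum, Finset.sum_range_succ', Finset.sum_range_succ'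
      (fun m => Ring.choose (n : k) m • ((conjEnd k u - 1) ^ m) x), Finset.sum_range_succ
      (fun m => (conjEnd k u - 1) (Ring.choose (n : k) m • ((conjEnd k u - 1) ^ m) x))]
    have e : ∀ m, (conjEnd k u - 1) (Ring.choose (n : k) m • ((conjEnd k u - 1) ^ m) x) =
        Ring.choose (n : k) m • ((conjEnd k u - 1) ^ (m + 1)) x := fun m => by
      rw [map_smul, pow_succ', Module.End.mul_apply]
    simp only [e, Int.cast_add, Int.cast_one, Ring.choose_succ_succ, add_smul,
      Finset.sum_add_distrib, Ring.choose_zero_right]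
    rw [pow_succ' _ N, Module.End.mul_apply, h, map_zero, smul_zero]
    abel

/-- If a product of `X - rₘ` with distinct `rₘ` annihilates `x` under conjugation, then `x` is
a sum of eigenvectors. -/
theorem exists_conj_zpow_eq_sum {r : ℕ → k} (N : ℕ) (hr0 : ∀ m, r m ≠ 0)
    (hr : Function.Injective r) (x : S)
    (h : Polynomial.aeval (conjEnd k u)
      (∏ m ∈ Finset.range N, (Polynomial.X - Polynomial.C (r m))) x = 0) :
    ∃ v : ℕ → S, ∀ n : ℤ, (u ^ n : Sˣ) * x * ((u ^ n)⁻¹ : Sˣ) =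
      ∑ m ∈ Finset.range N, r m ^ n • v m := by
  induction N generalizing x with
  | zero =>
    have hx : x = 0 := by simpa using h
    exact ⟨0, fun n => by simp [hx]⟩
  | succ N ih =>
    -- Distinct roots make the factors coprime, so the kernel of the product splits off the
    -- eigenspace of `r N`.
    have hcop : IsCoprime (∏ m ∈ Finset.range N, (Polynomial.X - Polynomial.C (r m)))
        (Polynomial.X - Polynomial.C (r N)) :=
      IsCoprime.prod_left fun m hm => Polynomial.isCoprime_X_sub_C_of_isUnit_sub
        (sub_ne_zero.2 fun e => (Finset.mem_range.1 hm).ne (hr e)).isUnit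
    rw [Finset.prod_range_succ] at h
    have hx : x ∈ _ := LinearMap.mem_ker.2 h
    rw [← Polynomial.sup_ker_aeval_eq_ker_aeval_mul_of_coprime _ hcop, Submodule.mem_sup] at hx
    obtain ⟨y, hy, z, hz, rfl⟩ := hx
    obtain ⟨v, hv⟩ := ih y (LinearMap.mem_ker.1 hy)
    have hz' : conjEnd k u z = r N • z := by
      have := LinearMap.mem_ker.1 hz
      simpa [sub_eq_zero, Algebra.algebraMap_eq_smul_one] using this
    refine ⟨Function.update v N z, fun n => ?_⟩
    rw [mul_add, add_mul, hv n, Finset.sum_range_succ, Function.update_self]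
    congr 1
    · refine Finset.sum_congr rfl fun m hm => ?_
      rw [Function.update_of_ne (Finset.mem_range.1 hm).ne]
    · refine conj_zpow_eq_of_step k u (h := fun n : ℤ => r N ^ n • z) (by simp) (fun n => ?_) n
      rw [map_smul, hz', smul_smul, zpow_add_one₀ (hr0 N)]

end Conjugation

/-! ### The algebra of parameter functions on the coroot lattice. -/

section CharacterAlgebra

variable {I : Type*} [DecidableEq I] {Qv : Type*} [AddCommGroup Qv] (R : CartanData I Qv)
variable (k : Type*) [Field k] (c : ℤ → k)

/-- The coroot lattice. -/
def corootLattice : AddSubgroup Qv := AddSubgroup.closure (Set.range R.coroot)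

theorem coroot_mem_corootLattice (i : I) : R.coroot i ∈ corootLattice R :=
  AddSubgroup.subset_closure ⟨i, rfl⟩

variable {k} in
/-- The function `lam ↦ c ⟨β, lam⟩` on the weight lattice. -/
def pairFun (b : Qv) : Module.Dual ℤ Qv → k := fun lam => c (lam b)

/-- The algebra generated by the functions `c ⟨β, lam⟩` for `β` in the coroot lattice. -/
def pairAlg : Subalgebra k (Module.Dual ℤ Qv → k) :=
  Algebra.adjoin k (pairFun c '' (corootLattice R : Set Qv))

variable {k c}

theorem pairFun_mem {b : Qv} (hb : b ∈ corootLattice R) : pairFun c b ∈ pairAlg R k c :=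
  Algebra.subset_adjoin ⟨b, hb, rfl⟩

/-- Substitution is an algebra endomorphism of the functions, so only generators matter. -/
theorem pairAlg_comp_mem {phi : Module.Dual ℤ Qv → Module.Dual ℤ Qv}
    (h : ∀ b ∈ corootLattice R, (fun lam => pairFun c b (phi lam)) ∈ pairAlg R k c)
    {b : Module.Dual ℤ Qv → k} (hb : b ∈ pairAlg R k c) :
    (fun lam => b (phi lam)) ∈ pairAlg R k c := by
  let F : (Module.Dual ℤ Qv → k) →ₐ[k] (Module.Dual ℤ Qv → k) :=
    AlgHom.pi fun lam => Pi.evalAlgHom k _ (phi lam)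
  have hle : pairAlg R k c ≤ (pairAlg R k c).comap F := by
    refine Algebra.adjoin_le ?_
    rintro _ ⟨b, hb, rfl⟩
    exact h b hb
  exact hle hb

/-- Reflecting the weight amounts to the dual reflection of `β`, which preserves the coroot lattice.
-/
theorem pairAlg_refl_mem {b : Module.Dual ℤ Qv → k} (hb : b ∈ pairAlg R k c) (i : I) :
    (fun lam => b (R.refl i lam)) ∈ pairAlg R k c := by
  refine pairAlg_comp_mem R (fun b hb => ?_) hb
  have : (fun lam => pairFun c b (R.refl i lam)) =
      pairFun c (b - R.root i b • R.coroot i) := by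
    funext lam
    rw [pairFun, pairFun, R.refl_apply, map_sub, map_smul, smul_eq_mul, mul_comm]
  rw [this]
  exact pairFun_mem R (sub_mem hb (zsmul_mem (coroot_mem_corootLattice R i) _))

/-- A coroot is determined by its pairing with the fundamental weights. -/
theorem eq_zero_of_fund_eq_zero [Fintype I] {b : Qv} (hb : b ∈ corootLattice R)
    (h : ∀ i, R.fund i b = 0) : b = 0 := by
  have key : b = ∑ i, R.fund i b • R.coroot i := by
    clear h
    induction hb using AddSubgroup.closure_induction with
    | mem x hx =>
      obtain ⟨j, rfl⟩ := hx
      simp [R.fund_coroot]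
    | zero => simp
    | add x y _ _ hx hy =>
      conv_lhs => rw [hx, hy]
      simp [add_smul, Finset.sum_add_distrib]
    | neg x _ hx =>
      conv_lhs => rw [hx]
      simp
  rw [key]
  simp [h]

variable {A : Type*} [Ring A] [Algebra k A] {f : I → A} {prm : Qv → WeightFun Qv (Loc k f)}

theorem isParameterAlgebra_pairAlg
    (hprm : ∀ b, prm b = scalarHom k Qv (Loc k f) (pairFun c b))
    (hscalar : ∀ b ∈ corootLattice R, scalarHom k Qv (Loc k f) (pairFun c b) ∈ polyAlg R k f prm)
    (hneg : ∀ b ∈ corootLattice R, ∀ d : Module.Dual ℤ Qv,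
      (fun lam => pairFun c b (-lam + d)) ∈ pairAlg R k c)
    (hzero : ∀ b ∈ pairAlg R k c, (∀ lam, R.IsDominant lam → b lam = 0) → b = 0)
    (hconj : ∀ i j, (fun lam => ((fUnit k f i ^ lam (R.coroot i) : (Loc k f)ˣ) : Loc k f) *
      toLoc k f (f j) * (((fUnit k f i ^ lam (R.coroot i))⁻¹ : (Loc k f)ˣ) : Loc k f) :
        WeightFun Qv (Loc k f)) ∈ (mixedHom (S := Loc k f) (pairAlg R k c)).range) :
    IsParameterAlgebra R k f prm (pairAlg R k c) where
  scalar_mem b hb := by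
    have hle : pairAlg R k c ≤ (polyAlg R k f prm).comap (scalarHom k Qv (Loc k f)) := by
      refine Algebra.adjoin_le ?_
      rintro _ ⟨b, hb, rfl⟩
      exact hscalar b hb
    exact hle hb
  coroot_mem i := ⟨_, pairFun_mem R (coroot_mem_corootLattice R i), hprm _⟩
  neg_coroot_mem i := ⟨_, pairFun_mem R (neg_mem (coroot_mem_corootLattice R i)), hprm _⟩
  refl_mem _ hb i := pairAlg_refl_mem R hb i
  neg_add_mem _ hb d := pairAlg_comp_mem R (fun b hb => hneg b hb d) hb
  eq_zero := hzero
  conj_mem := hconj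

theorem prm_coroot_mem_polyAlg (i : I) : prm (R.coroot i) ∈ polyAlg R k f prm :=
  Algebra.subset_adjoin (.inr (.inl ⟨i, rfl⟩))

theorem prm_neg_coroot_mem_polyAlg (i : I) : prm (-R.coroot i) ∈ polyAlg R k f prm :=
  Algebra.subset_adjoin (.inr (.inr ⟨i, rfl⟩))

/-- Conjugation of `fᵢ` by its own powers. -/
theorem conj_self_mem (B : Subalgebra k (Module.Dual ℤ Qv → k)) (i : I) :
    (fun lam => ((fUnit k f i ^ lam (R.coroot i) : (Loc k f)ˣ) : Loc k f) *
      toLoc k f (f i) * (((fUnit k f i ^ lam (R.coroot i))⁻¹ : (Loc k f)ˣ) : Loc k f) :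
        WeightFun Qv (Loc k f)) ∈ (mixedHom (S := Loc k f) B).range := by
  have h := constHom_mem_mixed (B := B) (toLoc k f (f i))
  refine Eq.mp (congrArg (· ∈ _) (funext fun lam => ?_)) h
  rw [constHom_apply, constFun, ← fUnit_val, ← Units.val_mul, ← Units.val_mul]
  congr 1
  rw [eq_mul_inv_iff_mul_eq, ← zpow_add_one, ← zpow_one_add, add_comm]

theorem sum_smul_mem_mixed {S : Type*} [Ring S] [Algebra k S]
    {B : Subalgebra k (Module.Dual ℤ Qv → k)} (N : ℕ) (b : ℕ → Module.Dual ℤ Qv → k)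
    (hb : ∀ m, b m ∈ B) (v : ℕ → S) :
    (fun lam => ∑ m ∈ Finset.range N, b m lam • v m : WeightFun Qv S) ∈
      (mixedHom (S := S) B).range := by
  have h : ∑ m ∈ Finset.range N, scalarHom k Qv S (b m) * constHom k Qv S (v m) ∈
      (mixedHom (S := S) B).range :=
    sum_mem fun m _ => mul_mem (scalarHom_mem_mixed (hb m)) (constHom_mem_mixed (v m))
  refine Eq.mp (congrArg (· ∈ _) (funext fun lam => ?_)) h
  refine (Finset.sum_apply lam _ _).trans ?_
  exact Finset.sum_congr rfl fun m _ => scalarHom_mul_constHom_apply _ _ _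

end CharacterAlgebra

/-! ### Serre relations and generation of `U(𝔫₋)`. -/

section LieCommutator

attribute [local instance] LieRing.ofAssociativeRing

theorem lieHom_ad_pow_apply {k : Type*} [CommRing k] {L L' : Type*} [LieRing L] [LieAlgebra k L]
    [LieRing L'] [LieAlgebra k L'] (phi : L →ₗ⁅k⁆ L') (n : ℕ) (x y : L) :
    phi ((LieAlgebra.ad k L x ^ n) y) = (LieAlgebra.ad k L' (phi x) ^ n) (phi y) := by
  induction n with
  | zero => simp
  | succ n ih =>
    rw [pow_succ', pow_succ', Module.End.mul_apply, Module.End.mul_apply, LieAlgebra.ad_apply,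
      LieAlgebra.ad_apply, LieHom.map_lie, ih]

theorem algHom_commutator_pow_apply {k : Type*} [CommRing k] {A A' : Type*} [Ring A] [Algebra k A]
    [Ring A'] [Algebra k A'] (phi : A →ₐ[k] A') (n : ℕ) (x y : A) :
    phi (((LinearMap.mulLeft k x - LinearMap.mulRight k x) ^ n) y) =
      ((LinearMap.mulLeft k (phi x) - LinearMap.mulRight k (phi x)) ^ n) (phi y) := by
  induction n with
  | zero => simp
  | succ n ih =>
    rw [pow_succ', pow_succ', Module.End.mul_apply, Module.End.mul_apply, ← ih]
    simp

variable {I : Type*} [DecidableEq I] {Qv : Type*} [AddCommGroup Qv] (R : CartanData I Qv)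

/-- The Serre relations in the Kac-Moody algebra. -/
theorem ad_kmf_pow_apply {i j : I} (h : i ≠ j) :
    (LieAlgebra.ad ℂ (KacMoody R) (kmf R i) ^ (1 - R.a i j).toNat) (kmf R j) = 0 := by
  have hmk : ∀ (n : ℕ) (x y : KMFree I Qv),
      LieSubmodule.Quotient.mk' (kmIdeal R) ((LieAlgebra.ad ℂ (KMFree I Qv) x ^ n) y) =
        (LieAlgebra.ad ℂ (KacMoody R) (LieSubmodule.Quotient.mk' (kmIdeal R) x) ^ n)
          (LieSubmodule.Quotient.mk' (kmIdeal R) y) := by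
    intro n x y
    induction n with
    | zero => simp
    | succ n ih =>
      rw [pow_succ', pow_succ', Module.End.mul_apply, Module.End.mul_apply, LieAlgebra.ad_apply,
        LieAlgebra.ad_apply, ← ih]
      exact LieSubmodule.Quotient.mk_bracket _ _ _
  rw [kmf, kmf, ← hmk, LieSubmodule.Quotient.mk_eq_zero]
  exact LieSubmodule.subset_lieSpan ⟨_, _, KMRel.serre_f i j h, (sub_zero _).symm⟩

/-- The Serre relations in `U(𝔫₋)`. -/
theorem commutator_uf_pow_apply {i j : I} (h : i ≠ j) :
    ((LinearMap.mulLeft ℂ (uf R i) - LinearMap.mulRight ℂ (uf R i)) ^ (1 - R.a i j).toNat)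
      (uf R j) = 0 := by
  let x : I → nMinus R := fun i => ⟨kmf R i, LieSubalgebra.subset_lieSpan (Set.mem_range_self i)⟩
  -- The relation descends to `𝔫₋` because the inclusion is injective; in the enveloping algebra
  -- `ad` becomes left minus right multiplication.
  have h1 : (LieAlgebra.ad ℂ (nMinus R) (x i) ^ (1 - R.a i j).toNat) (x j) = 0 := by
    apply Subtype.val_injective
    exact (lieHom_ad_pow_apply (nMinus R).incl _ (x i) (x j)).trans (ad_kmf_pow_apply R h)
  have h2 := congrArg (UniversalEnvelopingAlgebra.ι ℂ) h1
  rw [lieHom_ad_pow_apply, map_zero, LieAlgebra.ad_eq_lmul_left_sub_lmul_right] at h2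
  exact h2

/-- `U(𝔫₋)` is generated by the `fᵢ`. -/
theorem adjoin_range_uf : Algebra.adjoin ℂ (Set.range (uf R)) = ⊤ := by
  set T := Algebra.adjoin ℂ (Set.range (uf R)) with hT
  have hmem : ∀ x : nMinus R, UniversalEnvelopingAlgebra.ι ℂ x ∈ T := by
    rintro ⟨x, hx⟩
    induction hx using LieSubalgebra.lieSpan_induction with
    | mem x h =>
      obtain ⟨i, rfl⟩ := h
      exact Algebra.subset_adjoin ⟨i, rfl⟩
    | zero =>
      have e : UniversalEnvelopingAlgebra.ι ℂ (0 : nMinus R) = 0 := map_zero _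
      exact e ▸ zero_mem T
    | add x y hx hy ihx ihy =>
      have e := map_add (UniversalEnvelopingAlgebra.ι ℂ) (⟨x, hx⟩ : nMinus R) ⟨y, hy⟩
      exact e ▸ add_mem ihx ihy
    | smul a x hx ihx =>
      have e := map_smul (UniversalEnvelopingAlgebra.ι ℂ) a (⟨x, hx⟩ : nMinus R)
      exact e ▸ T.smul_mem ihx a
    | lie x y hx hy ihx ihy =>
      have e := (UniversalEnvelopingAlgebra.ι ℂ).map_lie (⟨x, hx⟩ : nMinus R) ⟨y, hy⟩
      rw [LieRing.of_associative_ring_bracket] at e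
      exact e ▸ sub_mem (mul_mem ihx ihy) (mul_mem ihy ihx)
  let g : nMinus R →ₗ⁅ℂ⁆ T :=
    { toFun := fun x => ⟨UniversalEnvelopingAlgebra.ι ℂ x, hmem x⟩
      map_add' := fun x y => Subtype.ext (map_add _ x y)
      map_smul' := fun a x => Subtype.ext (map_smul _ a x)
      map_lie' := fun {x y} => Subtype.ext ((UniversalEnvelopingAlgebra.ι ℂ).map_lie x y) }
  -- The universal property gives a map into `T` whose composite with the inclusion agrees with the
  -- identity on `𝔫₋`, so the inclusion is onto.
  have hid : T.val.comp (UniversalEnvelopingAlgebra.lift ℂ g) = AlgHom.id ℂ _ := by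
    apply UniversalEnvelopingAlgebra.hom_ext
    refine LieHom.ext fun x => ?_
    exact congrArg Subtype.val (UniversalEnvelopingAlgebra.lift_ι_apply ℂ g x)
  refine Algebra.eq_top_iff.2 fun x => ?_
  have := AlgHom.congr_fun hid x
  rw [AlgHom.id_apply] at this
  rw [← this]
  exact (UniversalEnvelopingAlgebra.lift ℂ g x).2

end LieCommutator

/-! ### The Kac-Moody case: polynomial dependence on weights. -/

section KacMoodyParameters

theorem kmParam_eq {I A Qv : Type*} [AddCommGroup Qv] [Ring A] [Algebra ℂ A] (f : I → A) (b : Qv) :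
    kmParam ℂ f b = scalarHom ℂ Qv (Loc ℂ f) (pairFun Int.cast b) := by
  funext lam
  exact (map_intCast (algebraMap ℂ (Loc ℂ f)) _).symm

variable {I : Type*} [DecidableEq I] {Qv : Type*} [AddCommGroup Qv] (R : CartanData I Qv)

theorem kmParam_mem_polyAlg {A : Type*} [Ring A] [Algebra ℂ A] (f : I → A) {b : Qv}
    (hb : b ∈ corootLattice R) : kmParam ℂ f b ∈ polyAlg R ℂ f (kmParam ℂ f) := by
  induction hb using AddSubgroup.closure_induction with
  | mem x hx =>
    obtain ⟨j, rfl⟩ := hx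
    exact prm_coroot_mem_polyAlg R j
  | zero =>
    have : kmParam ℂ f (0 : Qv) = 0 := by
      funext lam
      simp only [kmParam, map_zero, Int.cast_zero]
      rfl
    rw [this]
    exact zero_mem (polyAlg R ℂ f (kmParam ℂ f))
  | add x y _ _ hx hy =>
    have : kmParam ℂ f (x + y) = kmParam ℂ f x + kmParam ℂ f y := by
      funext lam
      simp only [kmParam, map_add, Int.cast_add]
      rfl
    rw [this]
    exact add_mem hx hy
  | neg x _ hx =>
    have : kmParam ℂ f (-x) = -kmParam ℂ f x := by
      funext lam
      simp only [kmParam, map_neg, Int.cast_neg]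
      rfl
    rw [this]
    exact neg_mem hx

theorem exists_mvPolynomial {b : Module.Dual ℤ Qv → ℂ} (hb : b ∈ pairAlg R ℂ Int.cast) :
    ∃ p : MvPolynomial I ℂ, ∀ lam, b lam =
      MvPolynomial.eval (fun i => ((lam (R.coroot i) : ℤ) : ℂ)) p := by
  let F : MvPolynomial I ℂ →ₐ[ℂ] (Module.Dual ℤ Qv → ℂ) :=
    MvPolynomial.aeval fun i => pairFun Int.cast (R.coroot i)
  have hle : pairAlg R ℂ Int.cast ≤ F.range := by
    refine Algebra.adjoin_le ?_
    rintro _ ⟨b, hb, rfl⟩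
    induction hb using AddSubgroup.closure_induction with
    | mem x hx =>
      obtain ⟨j, rfl⟩ := hx
      exact ⟨MvPolynomial.X j, MvPolynomial.aeval_X _ _⟩
    | zero =>
      have : pairFun (Int.cast : ℤ → ℂ) (0 : Qv) = 0 := by funext lam; simp [pairFun]
      rw [this]
      exact zero_mem F.range
    | add x y _ _ hx hy =>
      have : pairFun (Int.cast : ℤ → ℂ) (x + y) = pairFun Int.cast x + pairFun Int.cast y := by
        funext lam; simp [pairFun]
      rw [this]
      exact add_mem hx hy
    | neg x _ hx =>
      have : pairFun (Int.cast : ℤ → ℂ) (-x) = -pairFun Int.cast x := by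
        funext lam; simp [pairFun]
      rw [this]
      exact neg_mem hx
  obtain ⟨p, rfl⟩ := hle hb
  refine ⟨p, fun lam => ?_⟩
  have h : (Pi.evalAlgHom ℂ (fun _ : Module.Dual ℤ Qv => ℂ) lam).comp F =
      MvPolynomial.aeval fun i => ((lam (R.coroot i) : ℤ) : ℂ) := by
    refine MvPolynomial.algHom_ext fun i => ?_
    simp [F, pairFun]
  exact (AlgHom.congr_fun h p).trans (DFunLike.congr_fun (MvPolynomial.coe_aeval_eq_eval _) p)

end KacMoodyParameters

section KacMoodyCase

variable {I : Type*} [Fintype I] [DecidableEq I] {Qv : Type*} [AddCommGroup Qv]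
  (R : CartanData I Qv)

/-- The weight with prescribed pairings with the simple coroots. -/
theorem sum_fund_coroot (n : I → ℕ) (i : I) : (∑ j, (n j : ℤ) • R.fund j) (R.coroot i) = n i := by
  simp [R.fund_coroot]

theorem isDominant_sum_fund (n : I → ℕ) : R.IsDominant (∑ j, (n j : ℤ) • R.fund j) := by
  intro i
  rw [sum_fund_coroot]
  exact Int.natCast_nonneg _

/-- Combinations of fundamental weights realize every tuple in `ℕ^I` as dominant pairings, and a
polynomial vanishing on `ℕ^I` is zero. -/
theorem eq_zero_of_dominant {b : Module.Dual ℤ Qv → ℂ} (hb : b ∈ pairAlg R ℂ Int.cast)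
    (h : ∀ lam, R.IsDominant lam → b lam = 0) : b = 0 := by
  obtain ⟨p, hp⟩ := exists_mvPolynomial R hb
  have hp0 : p = 0 := by
    refine MvPolynomial.funext_set (fun _ => Set.range (Nat.cast : ℕ → ℂ))
      (fun _ => Set.infinite_range_of_injective Nat.cast_injective) fun x hx => ?_
    choose n hn using fun i => hx i (Set.mem_univ i)
    have h1 := h _ (isDominant_sum_fund R n)
    rw [hp] at h1
    have hx' : x = fun i => (((∑ j, (n j : ℤ) • R.fund j) (R.coroot i) : ℤ) : ℂ) := by
      funext i
      rw [← hn i, sum_fund_coroot, Int.cast_natCast]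
    rw [hx', h1, map_zero]
  funext lam
  rw [hp, hp0, map_zero, Pi.zero_apply]

theorem isParameterAlgebra_km :
    IsParameterAlgebra R ℂ (uf R) (kmParam ℂ (uf R)) (pairAlg R ℂ Int.cast) := by
  refine isParameterAlgebra_pairAlg R (kmParam_eq (uf R)) ?_ ?_ (fun b => eq_zero_of_dominant R) ?_
  · intro b hb
    rw [← kmParam_eq]
    exact kmParam_mem_polyAlg R (uf R) hb
  · intro b hb d
    have : (fun lam => pairFun (Int.cast : ℤ → ℂ) b (-lam + d)) =
        -pairFun Int.cast b + algebraMap ℂ (Module.Dual ℤ Qv → ℂ) (d b : ℤ) := by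
      funext lam
      simp [pairFun]
    rw [this]
    exact add_mem (neg_mem (pairFun_mem R hb)) (Subalgebra.algebraMap_mem _ _)
  · intro i j
    by_cases hij : i = j
    · subst hij
      exact conj_self_mem R _ i
    have hs := algHom_commutator_pow_apply (toLocHom ℂ (uf R)) (1 - R.a i j).toNat (uf R i) (uf R j)
    rw [commutator_uf_pow_apply R hij, map_zero, toLocHom_apply, toLocHom_apply, ← fUnit_val] at hs
    have hc := conj_zpow_eq_sum_choose ℂ (fUnit ℂ (uf R) i)
      (conjEnd_sub_one_pow_apply ℂ _ hs.symm)
    simp only [hc]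
    refine sum_smul_mem_mixed _
      (fun m lam => ((m.factorial : ℂ)⁻¹ • (descPochhammer ℤ m).smeval
        ((lam (R.coroot i) : ℤ) : ℂ))) (fun m => ?_) _
    -- Each binomial coefficient is a polynomial in the single parameter `αᵢ^∨`.
    have : (fun lam : Module.Dual ℤ Qv => ((m.factorial : ℂ)⁻¹ • (descPochhammer ℤ m).smeval
        ((lam (R.coroot i) : ℤ) : ℂ))) = (m.factorial : ℂ)⁻¹ •
          Polynomial.aeval (pairFun Int.cast (R.coroot i)) (descPochhammer ℤ m) := by
      funext lam
      rw [← Polynomial.aeval_eq_smeval]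
      exact congrArg _ (Polynomial.aeval_algHom_apply
        (Pi.evalRingHom (fun _ : Module.Dual ℤ Qv => ℂ) lam).toIntAlgHom
        (pairFun Int.cast (R.coroot i)) (descPochhammer ℤ m))
    rw [this]
    refine Subalgebra.smul_mem _ ?_ _
    have h1 := Polynomial.aeval_mem_adjoin_singleton ℤ
      (pairFun (Int.cast : ℤ → ℂ) (R.coroot i)) (p := descPochhammer ℤ m)
    have h2 : Algebra.adjoin ℤ {pairFun (Int.cast : ℤ → ℂ) (R.coroot i)} ≤
        (pairAlg R ℂ Int.cast).restrictScalars ℤ :=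
      Algebra.adjoin_le (Set.singleton_subset_iff.2
        (pairFun_mem R (coroot_mem_corootLattice R i)))
    exact h2 h1

end KacMoodyCase

/-! ### The `q`-binomial theorem and the `q`-Serre relation. -/

section QBinomial

theorem qFact_succ (p : Cq) (n : ℕ) : qFact p (n + 1) = qFact p n * qNum p (n + 1) :=
  Finset.prod_range_succ _ _

theorem qNum_zero (p : Cq) : qNum p 0 = 0 := by simp [qNum]

/-- The `q`-analogue of `n = (n - k) + k`, the source of the `q`-Pascal rule. -/
theorem qNum_split {p : Cq} (hp : p ≠ 0) {n k : ℕ} (h : k ≤ n) :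
    qNum p n = p ^ (k : ℤ) * qNum p (n - k) + p ^ (-((n - k : ℕ) : ℤ)) * qNum p k := by
  obtain ⟨m, rfl⟩ := Nat.exists_eq_add_of_le h
  rw [Nat.add_sub_cancel_left]
  simp only [qNum, ← mul_div_assoc, ← add_div, mul_sub, ← zpow_add₀ hp]
  congr 1
  push_cast
  rw [show (k : ℤ) + m = m + k by ring, show -((k : ℤ)) = -k by rfl,
    show (m : ℤ) + k = k + m by ring, show -((k : ℤ) + m) = -m + -k by ring,
    show (k : ℤ) + -m = -m + k by ring]
  ring

variable {p : Cq}

/-- The polynomial `∑ₖ (-z)ᵏ X^{N-k} / ([N-k]! [k]!)`. -/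
def qBinomPoly (p z : Cq) (N : ℕ) : Polynomial Cq :=
  ∑ k ∈ Finset.range (N + 1),
    Polynomial.C ((-z) ^ k * ((qFact p (N - k))⁻¹ * (qFact p k)⁻¹)) * Polynomial.X ^ (N - k)

/-- Splitting `[N+1]` in the `k`-th term gives two sums: one is `X` times the polynomial at `z p`,
the other, after an index shift, is `-z p^{-N}` times it. -/
theorem qBinomPoly_succ (hp : p ≠ 0) (hn : ∀ n, qNum p (n + 1) ≠ 0) (z : Cq) (N : ℕ) :
    Polynomial.C (qNum p (N + 1)) * qBinomPoly p z (N + 1) =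
      (Polynomial.X - Polynomial.C (z * p ^ (-(N : ℤ)))) * qBinomPoly p (z * p) N := by
  let A : ℕ → Polynomial Cq := fun k =>
    Polynomial.C ((-z) ^ k * (p ^ (k : ℤ) * qNum p (N + 1 - k)) *
      ((qFact p (N + 1 - k))⁻¹ * (qFact p k)⁻¹)) * Polynomial.X ^ (N + 1 - k)
  let B : ℕ → Polynomial Cq := fun k =>
    Polynomial.C ((-z) ^ k * (p ^ (-((N + 1 - k : ℕ) : ℤ)) * qNum p k) *
      ((qFact p (N + 1 - k))⁻¹ * (qFact p k)⁻¹)) * Polynomial.X ^ (N + 1 - k)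
  have h1 : Polynomial.C (qNum p (N + 1)) * qBinomPoly p z (N + 1) =
      ∑ k ∈ Finset.range (N + 2), A k + ∑ k ∈ Finset.range (N + 2), B k := by
    rw [qBinomPoly, Finset.mul_sum, ← Finset.sum_add_distrib]
    refine Finset.sum_congr rfl fun k hk => ?_
    have hk' : k ≤ N + 1 := Nat.lt_succ_iff.1 (Finset.mem_range.1 hk)
    simp only [A, B]
    rw [← add_mul, ← mul_assoc, ← Polynomial.C_mul, ← Polynomial.C_add, qNum_split hp hk']
    congr 2
    ring
  -- The end terms drop out since `[0] = 0`, leaving `N + 1` terms in each sum.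
  have hA : A (N + 1) = 0 := by simp [A, qNum_zero]
  have hB : B 0 = 0 := by simp [B, qNum_zero]
  rw [h1, Finset.sum_range_succ A, hA, add_zero, Finset.sum_range_succ' B, hB, add_zero, sub_mul,
    sub_eq_add_neg, qBinomPoly, Finset.mul_sum, Finset.mul_sum, ← Finset.sum_neg_distrib]
  congr 1
  · refine Finset.sum_congr rfl fun k hk => ?_
    have hk' : k ≤ N := Nat.lt_succ_iff.1 (Finset.mem_range.1 hk)
    obtain ⟨m, rfl⟩ := Nat.exists_eq_add_of_le hk'
    simp only [A]
    rw [show k + m + 1 - k = m + 1 by omega, show k + m - k = m by omega, qFact_succ, mul_inv,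
      pow_succ', mul_left_comm Polynomial.X, zpow_natCast]
    congr 2
    have := hn m
    rw [neg_mul_eq_neg_mul, mul_pow]
    field_simp
  · refine Finset.sum_congr rfl fun k hk => ?_
    have hk' : k ≤ N := Nat.lt_succ_iff.1 (Finset.mem_range.1 hk)
    obtain ⟨m, rfl⟩ := Nat.exists_eq_add_of_le hk'
    simp only [B]
    rw [show k + m + 1 - (k + 1) = m by omega, show k + m - k = m by omega, qFact_succ, mul_inv,
      ← mul_assoc (Polynomial.C _) (Polynomial.C _), ← Polynomial.C_mul, ← neg_mul,
      ← Polynomial.C_neg]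
    congr 2
    have := hn k
    have e : p ^ (-((k + m : ℕ) : ℤ)) = p ^ (-(m : ℤ)) * (p ^ k)⁻¹ := by
      rw [← zpow_natCast p k, ← zpow_neg, ← zpow_add₀ hp]
      congr 1
      push_cast
      ring
    have hpk : p ^ k ≠ 0 := pow_ne_zero _ hp
    rw [e, neg_mul_eq_neg_mul z p, mul_pow, pow_succ]
    field_simp

/-- The `q`-binomial theorem. -/
theorem qBinomPoly_eq_prod (hp : p ≠ 0) (hn : ∀ n, qNum p (n + 1) ≠ 0) (N : ℕ) (z : Cq) :
    Polynomial.C (qFact p N) * qBinomPoly p z N =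
      ∏ m ∈ Finset.range N,
        (Polynomial.X - Polynomial.C (z * p ^ ((N : ℤ) - 1 - 2 * m))) := by
  induction N generalizing z with
  | zero => simp [qFact, qBinomPoly]
  | succ N ih =>
    rw [qFact_succ, Polynomial.C_mul, mul_assoc, qBinomPoly_succ hp hn, mul_left_comm, ih,
      Finset.prod_range_succ, mul_comm]
    congr 1
    · refine Finset.prod_congr rfl fun m _ => ?_
      rw [mul_assoc, ← zpow_one_add₀ hp]
      congr 4
      push_cast
      ring
    · congr 4
      push_cast
      ring

/-- The `q`-Serre relation in terms of conjugation. -/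
theorem aeval_conjEnd_qBinomPoly {S : Type*} [Ring S] [Algebra Cq S] (u : Sˣ) (x : S) (N : ℕ) :
    Polynomial.aeval (conjEnd Cq u) (qBinomPoly p 1 N) x =
      qSerre p N (u : S) x * ((u⁻¹ : Sˣ) : S) ^ N := by
  rw [qBinomPoly, qSerre, map_sum, LinearMap.sum_apply, Finset.sum_mul]
  refine Finset.sum_congr rfl fun k hk => ?_
  have hk' : k ≤ N := Nat.lt_succ_iff.1 (Finset.mem_range.1 hk)
  obtain ⟨m, rfl⟩ := Nat.exists_eq_add_of_le hk'
  rw [Nat.add_sub_cancel_left, map_mul, map_pow, Polynomial.aeval_X, Polynomial.aeval_C,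
    Module.End.mul_apply, conjEnd_pow_apply, Module.algebraMap_end_apply, divPow, divPow, pow_add]
  -- Multiplying a Serre term by `u^{-N}` turns its right factor into `u^{-(N-k)}`, so the term is
  -- conjugation to the power `N - k`.
  have hu : (u : S) ^ k * (((u⁻¹ : Sˣ) : S) ^ k * ((u⁻¹ : Sˣ) : S) ^ m) =
      ((u⁻¹ : Sˣ) : S) ^ m := by
    rw [← mul_assoc, ← Units.val_pow_eq_pow_val, ← Units.val_pow_eq_pow_val, ← Units.val_mul,
      inv_pow, mul_inv_cancel, Units.val_one, one_mul]
  have hs : ((-1 : S)) ^ k = algebraMap Cq S ((-1) ^ k) := by simp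
  rw [hs, ← Algebra.smul_def]
  simp only [smul_mul_assoc, mul_smul_comm, smul_smul, mul_assoc, hu]
  congr 1
  ring

end QBinomial

/-! ### The indeterminate `q` has infinite order. -/

section Indeterminate

theorem qq_ne_zero : qq ≠ 0 := RatFunc.X_ne_zero

theorem qq_pow_ne_one {n : ℕ} (hn : 0 < n) : qq ^ n ≠ 1 := by
  intro h
  have h1 : (Polynomial.X : Polynomial ℂ) ^ n = 1 := by
    apply RatFunc.algebraMap_injective ℂ
    rw [map_pow, RatFunc.algebraMap_X, map_one]
    exact h
  have h2 := congrArg Polynomial.natDegree h1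
  rw [Polynomial.natDegree_X_pow, Polynomial.natDegree_one] at h2
  omega

theorem qq_zpow_injective : Function.Injective fun n : ℤ => qq ^ n := by
  have h : Function.Injective fun n : ℤ => (Units.mk0 qq qq_ne_zero) ^ n := by
    rw [injective_zpow_iff_not_isOfFinOrder, isOfFinOrder_iff_pow_eq_one]
    rintro ⟨n, hn, h⟩
    exact qq_pow_ne_one hn (by simpa using congrArg Units.val h)
  intro m n hmn
  apply h
  ext
  simpa using hmn

variable {I : Type*} [DecidableEq I] {Qv : Type*} [AddCommGroup Qv] (R : CartanData I Qv)

theorem qi_ne_zero (i : I) : qi R i ≠ 0 := pow_ne_zero _ qq_ne_zero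

theorem qi_zpow_injective (i : I) : Function.Injective fun n : ℤ => qi R i ^ n := by
  intro m n h
  simp only [qi, ← zpow_natCast, ← zpow_mul] at h
  have hd : (R.d i : ℤ) ≠ 0 := by
    have := R.d_pos i
    omega
  exact mul_left_cancel₀ hd (qq_zpow_injective h)

theorem qNum_qi_ne_zero (i : I) (n : ℕ) : qNum (qi R i) (n + 1) ≠ 0 := by
  refine div_ne_zero (sub_ne_zero.2 fun h => ?_) (sub_ne_zero.2 fun h => ?_)
  · have := qi_zpow_injective R i h
    omega
  · have : (1 : ℤ) = -1 := qi_zpow_injective R i (by simpa using h)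
    omega

end Indeterminate

/-! ### Serre relations and generation of `U_q(𝔫₋)`. -/

section QuantumSerre

theorem map_qSerre {S S' : Type*} [Ring S] [Algebra Cq S] [Ring S'] [Algebra Cq S']
    (phi : S →ₐ[Cq] S') (p : Cq) (N : ℕ) (x y : S) :
    phi (qSerre p N x y) = qSerre p N (phi x) (phi y) := by
  simp [qSerre, divPow]

theorem coe_qSerre {S : Type*} [Ring S] [Algebra Cq S] (T : Subalgebra Cq S) (p : Cq) (N : ℕ)
    (x y : T) : ((qSerre p N x y : T) : S) = qSerre p N (x : S) (y : S) :=
  map_qSerre T.val p N x y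

variable {I : Type*} [DecidableEq I] {Qv : Type*} [AddCommGroup Qv] (R : CartanData I Qv)

theorem qSerre_uqf {i j : I} (h : i ≠ j) :
    qSerre (qi R i) (1 - R.a i j).toNat (uqf R i) (uqf R j) = 0 := by
  have h1 := RingQuot.mkAlgHom_rel Cq (UqRel.serre_f (R := R) i j h)
  have h2 := map_qSerre (RingQuot.mkAlgHom Cq (UqRel R)) (qi R i) (1 - R.a i j).toNat (uqF Qv i)
    (uqF Qv j)
  exact h2.symm.trans (h1.trans (map_zero _))

/-- The `q`-Serre relations in `U_q(𝔫₋)`. -/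
theorem qSerre_uqMinusF {i j : I} (h : i ≠ j) :
    qSerre (qi R i) (1 - R.a i j).toNat (uqMinusF R i) (uqMinusF R j) = 0 := by
  have h1 := coe_qSerre (UqMinus R) (qi R i) (1 - R.a i j).toNat (uqMinusF R i) (uqMinusF R j)
  exact Subtype.ext (h1.trans (qSerre_uqf R h))

theorem adjoin_range_uqMinusF : Algebra.adjoin Cq (Set.range (uqMinusF R)) = ⊤ := by
  have h := Algebra.adjoin_adjoin_coe_preimage (R := Cq) (s := Set.range (uqf R))
  rw [← h]
  congr 1
  ext x
  constructor
  · rintro ⟨i, rfl⟩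
    exact ⟨i, rfl⟩
  · rintro ⟨i, hi⟩
    exact ⟨i, Subtype.ext hi⟩

end QuantumSerre

/-! ### The `q`-difference case: exponential dependence on weights. -/

section QParameters

theorem qParam_eq {I A Qv : Type*} [AddCommGroup Qv] [Ring A] [Algebra Cq A] (f : I → A) (b : Qv) :
    qParam f b = scalarHom Cq Qv (Loc Cq f) (pairFun (qq ^ ·) b) := rfl

theorem pairFun_qq_add {Qv : Type*} [AddCommGroup Qv] (x y : Qv) :
    pairFun (qq ^ · : ℤ → Cq) (x + y) = pairFun (qq ^ ·) x * pairFun (qq ^ ·) y := by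
  funext lam
  simp only [pairFun, map_add, Pi.mul_apply]
  exact zpow_add₀ qq_ne_zero _ _

theorem pairFun_qq_zero {Qv : Type*} [AddCommGroup Qv] :
    pairFun (qq ^ · : ℤ → Cq) (0 : Qv) = 1 := by
  funext lam
  simp [pairFun]

variable {I : Type*} [DecidableEq I] {Qv : Type*} [AddCommGroup Qv] (R : CartanData I Qv)

theorem qParam_mem_polyAlg {A : Type*} [Ring A] [Algebra Cq A] (f : I → A) {b : Qv}
    (hb : b ∈ corootLattice R) : qParam f b ∈ polyAlg R Cq f (qParam f) := by
  -- Negation of `β` inverts `q^β`, which a subalgebra need not allow, so both signs are carried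
  -- through the induction.
  have key : qParam f b ∈ polyAlg R Cq f (qParam f) ∧ qParam f (-b) ∈ polyAlg R Cq f (qParam f) := by
    induction hb using AddSubgroup.closure_induction with
    | mem x hx =>
      obtain ⟨j, rfl⟩ := hx
      exact ⟨prm_coroot_mem_polyAlg R j, prm_neg_coroot_mem_polyAlg R j⟩
    | zero =>
      rw [neg_zero, and_self, qParam_eq, pairFun_qq_zero, map_one]
      exact one_mem (polyAlg R Cq f (qParam f))
    | add x y _ _ hx hy =>
      rw [neg_add, qParam_eq, qParam_eq, pairFun_qq_add, pairFun_qq_add, map_mul, map_mul]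
      exact ⟨mul_mem hx.1 hy.1, mul_mem hx.2 hy.2⟩
    | neg x _ hx => exact ⟨hx.2, by rw [neg_neg]; exact hx.1⟩
  exact key.1

/-- The monoid of dominant weights. -/
def dominantSubmonoid : AddSubmonoid (Module.Dual ℤ Qv) where
  carrier := {lam | R.IsDominant lam}
  zero_mem' _ := le_rfl
  add_mem' h h' i := add_nonneg (h i) (h' i)

/-- The character `lam ↦ q^{⟨β, lam⟩}` of the monoid of dominant weights. -/
def dominantCharacter (b : Qv) : Multiplicative (dominantSubmonoid R) →* Cq where
  toFun lam := qq ^ (lam.toAdd.1 b)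
  map_one' := zpow_zero _
  map_mul' _ _ := zpow_add₀ qq_ne_zero _ _

theorem isDominant_fund (i : I) : R.IsDominant (R.fund i) := by
  intro j
  rw [R.fund_coroot]
  split_ifs <;> norm_num

/-- Fundamental weights are dominant and separate the coroot lattice, and powers of `q` determine
their exponents. -/
theorem dominantCharacter_injective [Fintype I] :
    Function.Injective fun b : corootLattice R => dominantCharacter R b.1 := by
  intro b b' h
  rw [← sub_eq_zero]
  apply Subtype.val_injective
  refine eq_zero_of_fund_eq_zero R (b - b').2 fun i => ?_
  have h1 := DFunLike.congr_fun h (Multiplicative.ofAdd ⟨R.fund i, isDominant_fund R i⟩)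
  have h2 : R.fund i b.1 = R.fund i b'.1 := qq_zpow_injective h1
  rw [AddSubgroup.coe_sub, map_sub, h2, sub_self]

/-- The generators are closed under products, so the algebra is their span; restricted to the monoid
of dominant weights they are distinct characters, independent by Dedekind. -/
theorem pairAlg_qq_eq_zero [Fintype I] {b : Module.Dual ℤ Qv → Cq}
    (hb : b ∈ pairAlg R Cq (qq ^ ·)) (h : ∀ lam, R.IsDominant lam → b lam = 0) : b = 0 := by
  let chi : Multiplicative (corootLattice R) →* (Module.Dual ℤ Qv → Cq) :=
    { toFun := fun b => pairFun (qq ^ ·) b.toAdd.1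
      map_one' := pairFun_qq_zero
      map_mul' := fun _ _ => pairFun_qq_add _ _ }
  have hspan : b ∈ Submodule.span Cq
      (Set.range fun b : corootLattice R => pairFun (qq ^ · : ℤ → Cq) b.1) := by
    have h1 : b ∈ Subalgebra.toSubmodule (pairAlg R Cq (qq ^ ·)) := hb
    rw [pairAlg, Algebra.adjoin_eq_span] at h1
    refine Submodule.span_mono ?_ h1
    have h2 : Submonoid.closure (pairFun (qq ^ · : ℤ → Cq) '' (corootLattice R : Set Qv)) ≤
        MonoidHom.mrange chi := by
      rw [Submonoid.closure_le]
      rintro _ ⟨x, hx, rfl⟩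
      exact ⟨Multiplicative.ofAdd ⟨x, hx⟩, rfl⟩
    intro y hy
    obtain ⟨x, hx⟩ := h2 hy
    exact ⟨x.toAdd, hx⟩
  obtain ⟨c, rfl⟩ := Finsupp.mem_span_range_iff_exists_finsupp.1 hspan
  have hli := (linearIndependent_monoidHom (Multiplicative (dominantSubmonoid R)) Cq).comp _
    (dominantCharacter_injective R)
  have hc : c = 0 := by
    refine linearIndependent_iff.1 hli c ?_
    funext lam
    have h1 := h _ lam.toAdd.2
    rw [Finsupp.linearCombination_apply, Finsupp.sum, Finset.sum_apply]
    rw [Finsupp.sum, Finset.sum_apply] at h1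
    exact h1
  rw [hc, Finsupp.sum_zero_index]

theorem isParameterAlgebra_q [Fintype I] :
    IsParameterAlgebra R Cq (uqMinusF R) (qParam (uqMinusF R)) (pairAlg R Cq (qq ^ ·)) := by
  refine isParameterAlgebra_pairAlg R (qParam_eq (uqMinusF R))
    (fun b hb => qParam_mem_polyAlg R (uqMinusF R) hb) ?_ (fun b => pairAlg_qq_eq_zero R) ?_
  · intro b hb d
    have : (fun lam => pairFun (qq ^ · : ℤ → Cq) b (-lam + d)) =
        qq ^ (d b) • pairFun (qq ^ · : ℤ → Cq) (-b) := by
      funext lam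
      simp only [pairFun, LinearMap.add_apply, LinearMap.neg_apply, Pi.smul_apply, smul_eq_mul,
        map_neg]
      rw [zpow_add₀ qq_ne_zero, mul_comm]
    rw [this]
    exact Subalgebra.smul_mem _ (pairFun_mem R (neg_mem hb)) _
  · intro i j
    by_cases hij : i = j
    · subst hij
      exact conj_self_mem R _ i
    set N := (1 - R.a i j).toNat with hN
    have hs := (map_qSerre (toLocHom Cq (uqMinusF R)) (qi R i) N _ _).symm.trans
      ((congrArg _ (qSerre_uqMinusF R hij)).trans (map_zero _))
    rw [toLocHom_apply, toLocHom_apply, ← fUnit_val] at hs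
    -- The `q`-Serre relation says that conjugation by `fᵢ` satisfies this product at `fⱼ`; its
    -- roots are distinct because the exponents `N - 1 - 2m` are.
    have h0 : Polynomial.aeval (conjEnd Cq (fUnit Cq (uqMinusF R) i))
        (∏ m ∈ Finset.range N, (Polynomial.X -
          Polynomial.C (qi R i ^ ((N : ℤ) - 1 - 2 * m)))) (toLoc Cq (uqMinusF R) (uqMinusF R j)) =
        0 := by
      have hb := qBinomPoly_eq_prod (qi_ne_zero R i) (qNum_qi_ne_zero R i) N 1
      simp only [one_mul] at hb
      rw [← hb, map_mul, Module.End.mul_apply, aeval_conjEnd_qBinomPoly, hs, zero_mul, map_zero]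
    obtain ⟨v, hv⟩ := exists_conj_zpow_eq_sum Cq (fUnit Cq (uqMinusF R) i)
      (r := fun m : ℕ => qi R i ^ ((N : ℤ) - 1 - 2 * m)) N
      (fun m => zpow_ne_zero _ (qi_ne_zero R i))
      (fun m n h => by have := qi_zpow_injective R i h; omega) _ h0
    simp only [hv]
    refine sum_smul_mem_mixed N
      (fun m lam => (qi R i ^ ((N : ℤ) - 1 - 2 * m)) ^ lam (R.coroot i)) (fun m => ?_) v
    -- Since `qᵢ = q^{dᵢ}`, each eigenvalue power is the character of an integer multiple of `αᵢ^∨`.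
    have : (fun lam : Module.Dual ℤ Qv => (qi R i ^ ((N : ℤ) - 1 - 2 * m)) ^ lam (R.coroot i)) =
        pairFun (qq ^ · : ℤ → Cq) (((R.d i : ℤ) * ((N : ℤ) - 1 - 2 * m)) • R.coroot i) := by
      funext lam
      simp only [pairFun, qi, ← zpow_natCast, ← zpow_mul, map_smul, smul_eq_mul]
    rw [this]
    exact pairFun_mem R (zsmul_mem (coroot_mem_corootLattice R i) _)

end QParameters

end QuantumTau

end

open QuantumTau in
theorem proposition2 {I : Type*} [Fintype I] [DecidableEq I]
    {Qv : Type*} [AddCommGroup Qv] [Module.Free ℤ Qv] (R : CartanData I Qv)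
    (hroot : LinearIndependent ℤ R.root) :
    -- the Kac-Moody case
    ((∀ lam mu : Module.Dual ℤ Qv, R.IsDominant lam → R.IsDominant mu →
        ∀ (w : R.Weyl) (l : List I), R.IsReducedExpr w l →
          ∃ u : UMinus R, singF R (uf R) l (lam + mu) = u * singF R (uf R) l lam) →
      ∀ mu : Module.Dual ℤ Qv, R.IsDominant mu →
        ∀ (w : R.Weyl) (l : List I), R.IsReducedExpr w l →
          IsRegular R ℂ (uf R) (kmParam ℂ (uf R)) (R.act l mu) (tauFun R ℂ (uf R) l mu)) ∧
    -- the q-difference case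
    ((∀ lam mu : Module.Dual ℤ Qv, R.IsDominant lam → R.IsDominant mu →
        ∀ (w : R.Weyl) (l : List I), R.IsReducedExpr w l →
          ∃ u : UqMinus R,
            singF R (uqMinusF R) l (lam + mu) = u * singF R (uqMinusF R) l lam) →
      ∀ mu : Module.Dual ℤ Qv, R.IsDominant mu →
        ∀ (w : R.Weyl) (l : List I), R.IsReducedExpr w l →
          IsRegular R Cq (uqMinusF R) (qParam (uqMinusF R)) (R.act l mu)
            (tauFun R Cq (uqMinusF R) l mu)) :=
  ⟨fun hF _ hmu _ _ hl => (isParameterAlgebra_km R).isRegular (adjoin_range_uf R) hF hmu hl,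
    fun hF _ hmu _ _ hl => (isParameterAlgebra_q R).isRegular (adjoin_range_uqMinusF R) hF hmu hl⟩
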